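/- For $p\in(0,1)$ let $f_p(u)=u|u|^{p-1}$ (with $f_p(0)=0$), and call $w:\mathbb{R}\to\mathbb{R}$ a front profile with exponent $p$ if $w\in C^2(\mathbb{R})$ is odd, satisfies \[ w''+\tfrac12\eta w'+f_p(w)-\tfrac{1}{1-p}w=0 \quad\text{on }\mathbb{R}, \] $|w(\eta)|<(1-p)^{1/(1-p)}$ for all $\eta$, $w(\eta)\to\pm(1-p)^{1/(1-p)}$ and $w'(\eta)\to0$ as $\eta\to\pm\infty$, and $0<w'(\eta)<w'(0)$ for all $\eta\neq0$. For $t>0$ let \[ \mathcal{F}_t(f,v,u)=\sup_{x\in\mathbb{R}}|v'(x)|+\frac{1}{\sqrt\pi}\int_0^t\frac{\sup_{x\in\mathbb{R}}|f(u(x,\tau))|}{(t-\tau)^{1/2}}\,d\tau, \] and let \[ \phi(p)=\frac{(1-p)^{p/(1-p)}\,\Gamma\left(\frac{1}{1-p}\right)}{\Gamma\left(\frac{3-p}{2(1-p)}\right)}\qquad(0<p<1),\qquad p_n=\frac{1}{2n}\qquad(n\ge1). \] Then a front profile exists for every $p\in(0,1)$. Moreover, for every choice of front profiles $w_p$ with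 exponent $p$, $p\in(0,1)$: (i) there is a subsequence $(p_{n_l})_l$ of $(p_n)_n$ (so $1\le n_1<n_2<\cdots$ and $p_{n_l}\to0$) such that $w_{p_{n_l}}'(0)\to\dfrac{2}{\sqrt\pi}$ as $l\to\infty$; (ii) for all $p\in(0,1)$ and $t>0$, with $u^{(p)}(x,\tau)=w_p(x\tau^{-1/2})\,\tau^{1/(1-p)}$ for $\tau>0$ and $u^{(p)}(x,0)=0$, one has $\mathcal{F}_t(f_p,0,u^{(p)})=\phi(p)\,t^{(1+p)/(2(1-p))}$. Finally, $\phi(p)\to\dfrac{2}{\sqrt\pi}$ as $p\to0^+$, so the limits in (i) and of $\phi$ coincide. -/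

import Mathlib

open Set Filter Topology

noncomputable section

/-- The nonlinearity `f_p(u) = u |u|^(p-1)`, with `f_p(0) = 0`. -/
def fNonlin (p u : ℝ) : ℝ := u * |u| ^ (p - 1)

/-- The far-field value `(1-p)^(1/(1-p))`. -/
def frontLimit (p : ℝ) : ℝ := (1 - p) ^ (1 / (1 - p))

/-- `w` is a front profile with exponent `p`: an odd, `C²` solution on the whole line of
`w'' + (η/2) w' + f_p(w) - w/(1-p) = 0`, taking values strictly between `∓(1-p)^(1/(1-p))`, which
are its limits at `∓∞`, with `w' → 0` at `±∞`, and `0 < w'(η) < w'(0)` for all `η ≠ 0` (so that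
`w'(0)` is the supremum of `|w'|`). -/
structure IsFrontProfile (p : ℝ) (w : ℝ → ℝ) : Prop where
  contDiff : ContDiff ℝ 2 w
  ode : ∀ η : ℝ,
    deriv (deriv w) η + η / 2 * deriv w η + fNonlin p (w η) - 1 / (1 - p) * w η = 0
  odd : ∀ η : ℝ, w (-η) = -w η
  abs_lt : ∀ η : ℝ, |w η| < frontLimit p
  tendsto_atTop : Tendsto w atTop (𝓝 (frontLimit p))
  tendsto_atBot : Tendsto w atBot (𝓝 (-frontLimit p))
  deriv_tendsto_atTop : Tendsto (deriv w) atTop (𝓝 0)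
  deriv_tendsto_atBot : Tendsto (deriv w) atBot (𝓝 0)
  deriv_pos_lt : ∀ η : ℝ, η ≠ 0 → 0 < deriv w η ∧ deriv w η < deriv w 0

/-- The self-similar function `u(x,t) = w(x t^(-1/2)) t^(1/(1-p))`; it vanishes at `t = 0`. -/
def selfSimilar (p : ℝ) (w : ℝ → ℝ) (x t : ℝ) : ℝ :=
  w (x / √t) * t ^ (1 / (1 - p))

/-- The supremum norm on bounded functions on the line. -/
def supNorm (g : ℝ → ℝ) : ℝ := ⨆ x : ℝ, |g x|

/-- The derivative-bound functional
`‖v'‖ + π^(-1/2) ∫₀^t ‖f(u(·,τ))‖ (t-τ)^(-1/2) dτ`. -/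
def derivFunctional (t : ℝ) (f v : ℝ → ℝ) (u : ℝ → ℝ → ℝ) : ℝ :=
  supNorm (deriv v) +
    1 / √Real.pi * ∫ τ in (0 : ℝ)..t, supNorm (fun x => f (u x τ)) / √(t - τ)

/-- `φ(p) = (1-p)^(p/(1-p)) Γ(1/(1-p)) / Γ((3-p)/(2(1-p)))`. -/
def phiBound (p : ℝ) : ℝ :=
  (1 - p) ^ (p / (1 - p)) * Real.Gamma (1 / (1 - p)) / Real.Gamma ((3 - p) / (2 * (1 - p)))

/-- The sequence `p_n = 1/(2n)`, used for `n ≥ 1`. -/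
def pSeq (n : ℕ) : ℝ := 1 / (2 * (n : ℝ))

end

/-!
With `weight x = e^(x²/4)` the profile equation is `w'' + (x/2) w' - w = -source p w`, where
`source p u = f_p(u) - (p/(1-p)) u`. The linear part does not depend on `p` and is explicitly
solvable: `1 + x²/2` is an even solution of the homogeneous equation, and `oddSol`, `decaySol` are
an odd one and one decaying at `+∞`, built from the Gaussian integral. Moreover `source p` is
increasing on `[0, L]`, `L = (1-p)^(1/(1-p))`, vanishes at `0` and fixes `L`.

*Existence.* The Green operator `greenOp` of the linear part is positive and preserves monotone
functions on `[0, ∞)`, and it maps odd functions to odd functions. Iterating `greenOp ∘ source p`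
from a supersolution gives a decreasing sequence of monotone functions. It does not collapse to `0`,
since `source p` is sublinear (`p < 1`) and hence small multiples of a fixed function are
subsolutions (`exists_pos_le_profileIter`). By dominated convergence the limit is a fixed point, and
`isFrontProfile_of_fixedPoint` reads off the properties of a front profile from the equation.

*Slope at the origin.* Green's identity with `decaySol` gives, for every front profile,
`w'(0) = ∫₀^∞ decaySol * weight * source p w` (`deriv_profile_zero_eq`). The energy
`w'²/2 + potential p w` decreases along the profile, which bounds `w` below at each `x > 0`
uniformly in small `p` (`min_le_profile`), so that `source p w → 1` pointwise as `p → 0`. Dominated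
convergence gives `w'(0) → ∫₀^∞ decaySol * weight = -decaySol' 0 = 2/√π`. In fact the whole sequence
converges.

*The functional.* The supremum of `|f_p(u(·, τ))|` is `L^p τ^(p/(1-p))` because `w` tends to `L`,
and the remaining integral is a Beta integral. The limit of `phiBound` is continuity of the Gamma
function, with `Γ(3/2) = √π/2`.
-/

open MeasureTheory

namespace FrontProfile

/-! ### Solutions of the linear equation `h'' + (x/2) h' = h` -/

/-- The integrating factor `e^(x²/4)` of the operator `h ↦ h'' + (x/2) h'`. -/
noncomputable def weight (x : ℝ) : ℝ := Real.exp (x ^ 2 / 4)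

/-- The Gaussian `e^(-x²/4)`, the inverse of `weight`. -/
noncomputable def gauss (x : ℝ) : ℝ := Real.exp (-(x ^ 2 / 4))

/-- The Gaussian primitive `∫₀ˣ e^(-s²/4) ds`. -/
noncomputable def gaussInt (x : ℝ) : ℝ := ∫ s in (0 : ℝ)..x, gauss s

/-- The even (polynomial) solution of `h'' + (x/2) h' = h`, with value `1` at the origin. -/
noncomputable def evenSol (x : ℝ) : ℝ := 1 + x ^ 2 / 2

/-- The odd solution of `h'' + (x/2) h' = h`, with derivative `1` at the origin. -/
noncomputable def oddSol (x : ℝ) : ℝ := (evenSol x * gaussInt x + x * gauss x) / 2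

/-- The derivative of `oddSol`. -/
noncomputable def oddSol' (x : ℝ) : ℝ := (x * gaussInt x + 2 * gauss x) / 2

/-- The solution of `h'' + (x/2) h' = h` with `h(0) = 1` that decays at `+∞`. -/
noncomputable def decaySol (x : ℝ) : ℝ := evenSol x - 2 / √Real.pi * oddSol x

/-- The derivative of `decaySol`. -/
noncomputable def decaySol' (x : ℝ) : ℝ := x - 2 / √Real.pi * oddSol' x

/-- The Gaussian tail `∫ₓ^∞ e^(-s²/4) ds`, as the difference of the full half-line integral `√π`
and `gaussInt x`. -/
noncomputable def gaussTail (x : ℝ) : ℝ := √Real.pi - gaussInt x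

lemma sqrt_pi_pos : 0 < √Real.pi := Real.sqrt_pos.2 Real.pi_pos

lemma weight_pos (x : ℝ) : 0 < weight x := Real.exp_pos _

lemma gauss_pos (x : ℝ) : 0 < gauss x := Real.exp_pos _

lemma weight_mul_gauss (x : ℝ) : weight x * gauss x = 1 := by
  rw [weight, gauss, ← Real.exp_add]; simp

lemma one_le_weight (x : ℝ) : 1 ≤ weight x := Real.one_le_exp (by positivity)

lemma weight_zero : weight 0 = 1 := by simp [weight]

lemma gauss_zero : gauss 0 = 1 := by simp [gauss]

lemma weight_neg (x : ℝ) : weight (-x) = weight x := by simp [weight]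

lemma gauss_neg (x : ℝ) : gauss (-x) = gauss x := by simp [gauss]

lemma continuous_gauss : Continuous gauss := by unfold gauss; fun_prop

lemma continuous_weight : Continuous weight := by unfold weight; fun_prop

lemma hasDerivAt_weight (x : ℝ) : HasDerivAt weight (x / 2 * weight x) x := by
  have h := (((hasDerivAt_id x).pow 2).div_const 4).exp
  refine HasDerivAt.congr_deriv (h) ?_
  simp [weight]; ring

lemma hasDerivAt_gauss (x : ℝ) : HasDerivAt gauss (-(x / 2) * gauss x) x := by
  have h := (((hasDerivAt_id x).pow 2).div_const 4).neg.exp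
  refine HasDerivAt.congr_deriv (h) ?_
  simp [gauss]; ring

lemma hasDerivAt_gaussInt (x : ℝ) : HasDerivAt gaussInt (gauss x) x :=
  continuous_gauss.integral_hasStrictDerivAt 0 x |>.hasDerivAt

lemma gaussInt_zero : gaussInt 0 = 0 := by simp [gaussInt]

lemma gaussInt_neg (x : ℝ) : gaussInt (-x) = -gaussInt x := by
  have h := intervalIntegral.integral_comp_neg (a := 0) (b := x) gauss
  simp only [gauss_neg, neg_zero] at h
  rw [gaussInt, gaussInt, h, intervalIntegral.integral_symm]

lemma gaussInt_nonneg {x : ℝ} (hx : 0 ≤ x) : 0 ≤ gaussInt x :=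
  intervalIntegral.integral_nonneg hx fun s _ => (gauss_pos s).le

lemma tendsto_gaussInt : Tendsto gaussInt atTop (𝓝 (√Real.pi)) := by
  have hg : gauss = fun x : ℝ => Real.exp (-(1 / 4) * x ^ 2) := by
    ext x; simp only [gauss]; congr 1; ring
  have h1 : ∫ x in Ioi (0 : ℝ), gauss x = √Real.pi := by
    rw [hg, integral_gaussian_Ioi, Real.sqrt_div' _ (by norm_num),
      show (1 / 4 : ℝ) = (1 / 2) ^ 2 by norm_num, Real.sqrt_sq (by norm_num)]
    ring
  rw [← h1]
  refine intervalIntegral_tendsto_integral_Ioi 0 ?_ tendsto_id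
  rw [hg]
  exact (integrable_exp_neg_mul_sq (by norm_num)).integrableOn

lemma tendsto_gauss : Tendsto gauss atTop (𝓝 0) := by
  refine Real.tendsto_exp_neg_atTop_nhds_zero.comp ?_
  exact (tendsto_pow_atTop two_ne_zero).atTop_div_const (by norm_num)

lemma hasDerivAt_evenSol (x : ℝ) : HasDerivAt evenSol x x := by
  have h := (((hasDerivAt_id x).pow 2).div_const 2).const_add 1
  refine HasDerivAt.congr_deriv (h) ?_
  simp

lemma hasDerivAt_oddSol (x : ℝ) : HasDerivAt oddSol (oddSol' x) x := by
  have h := (((hasDerivAt_evenSol x).mul (hasDerivAt_gaussInt x)).add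
    ((hasDerivAt_id x).mul (hasDerivAt_gauss x))).div_const 2
  refine HasDerivAt.congr_deriv (h) ?_
  simp [oddSol', evenSol]; ring

lemma hasDerivAt_oddSol' (x : ℝ) : HasDerivAt oddSol' (oddSol x - x / 2 * oddSol' x) x := by
  have h := (((hasDerivAt_id x).mul (hasDerivAt_gaussInt x)).add
    ((hasDerivAt_gauss x).const_mul 2)).div_const 2
  refine HasDerivAt.congr_deriv (h) ?_
  simp [oddSol', oddSol, evenSol]; ring

lemma hasDerivAt_decaySol (x : ℝ) : HasDerivAt decaySol (decaySol' x) x :=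
  (hasDerivAt_evenSol x).sub ((hasDerivAt_oddSol x).const_mul _)

lemma hasDerivAt_decaySol' (x : ℝ) :
    HasDerivAt decaySol' (decaySol x - x / 2 * decaySol' x) x := by
  have h := (hasDerivAt_id x).sub ((hasDerivAt_oddSol' x).const_mul (2 / √Real.pi))
  refine HasDerivAt.congr_deriv (h) ?_
  simp [decaySol', decaySol, evenSol]; ring

lemma continuous_evenSol : Continuous evenSol :=
  continuous_iff_continuousAt.2 fun x => (hasDerivAt_evenSol x).continuousAt

lemma continuous_oddSol : Continuous oddSol :=
  continuous_iff_continuousAt.2 fun x => (hasDerivAt_oddSol x).continuousAt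

lemma continuous_decaySol : Continuous decaySol :=
  continuous_iff_continuousAt.2 fun x => (hasDerivAt_decaySol x).continuousAt

lemma hasDerivAt_weight_mul_oddSol' (x : ℝ) :
    HasDerivAt (fun y => weight y * oddSol' y) (oddSol x * weight x) x := by
  refine HasDerivAt.congr_deriv ((hasDerivAt_weight x).mul (hasDerivAt_oddSol' x)) ?_
  ring

lemma hasDerivAt_weight_mul_decaySol' (x : ℝ) :
    HasDerivAt (fun y => weight y * decaySol' y) (decaySol x * weight x) x := by
  refine HasDerivAt.congr_deriv ((hasDerivAt_weight x).mul (hasDerivAt_decaySol' x)) ?_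
  ring

lemma evenSol_neg (x : ℝ) : evenSol (-x) = evenSol x := by simp [evenSol]

lemma oddSol_neg (x : ℝ) : oddSol (-x) = -oddSol x := by
  simp [oddSol, evenSol_neg, gaussInt_neg, gauss_neg]; ring

lemma oddSol_zero : oddSol 0 = 0 := by simp [oddSol, gaussInt_zero]

lemma oddSol'_zero : oddSol' 0 = 1 := by simp [oddSol', gauss_zero]

lemma decaySol_zero : decaySol 0 = 1 := by simp [decaySol, oddSol_zero, evenSol]

lemma decaySol'_zero : decaySol' 0 = -(2 / √Real.pi) := by simp [decaySol', oddSol'_zero]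

lemma wronskian_even_odd (x : ℝ) : weight x * (evenSol x * oddSol' x - x * oddSol x) = 1 := by
  rw [← weight_mul_gauss x]
  congr 1
  simp only [evenSol, oddSol, oddSol']; ring

lemma wronskian_decay_odd (x : ℝ) :
    weight x * (decaySol x * oddSol' x - decaySol' x * oddSol x) = 1 := by
  rw [← wronskian_even_odd x, decaySol, decaySol']
  ring

lemma oddSol_nonneg {x : ℝ} (hx : 0 ≤ x) : 0 ≤ oddSol x := by
  have := gaussInt_nonneg hx
  have := (gauss_pos x).le
  have : 0 ≤ evenSol x := by unfold evenSol; positivity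
  unfold oddSol; positivity

lemma oddSol_pos {x : ℝ} (hx : 0 < x) : 0 < oddSol x := by
  have := gaussInt_nonneg hx.le
  have := gauss_pos x
  have : 0 ≤ evenSol x := by unfold evenSol; positivity
  unfold oddSol; positivity

lemma oddSol'_pos {x : ℝ} (hx : 0 ≤ x) : 0 < oddSol' x := by
  have := gaussInt_nonneg hx
  have := gauss_pos x
  unfold oddSol'; positivity

lemma oddSol_monotoneOn : MonotoneOn oddSol (Ici 0) := by
  refine monotoneOn_of_hasDerivWithinAt_nonneg (convex_Ici 0) continuous_oddSol.continuousOn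
    (fun x _ => (hasDerivAt_oddSol x).hasDerivWithinAt) fun x hx => ?_
  rw [interior_Ici] at hx
  exact (oddSol'_pos (le_of_lt hx)).le

lemma hasDerivAt_gaussTail (x : ℝ) : HasDerivAt gaussTail (-gauss x) x := by
  exact (hasDerivAt_gaussInt x).const_sub (√Real.pi)

lemma tendsto_gaussTail : Tendsto gaussTail atTop (𝓝 0) := by
  have h := tendsto_gaussInt.const_sub (√Real.pi)
  rwa [sub_self] at h

lemma strictAntiOn_of_hasDerivAt_neg {g g' : ℝ → ℝ} (hg : ∀ x, HasDerivAt g (g' x) x)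
    (hneg : ∀ x, 0 < x → g' x < 0) : StrictAntiOn g (Ici 0) := by
  refine strictAntiOn_of_deriv_neg (convex_Ici 0)
    (fun y _ => (hg y).continuousAt.continuousWithinAt) fun y hy => ?_
  rw [interior_Ici] at hy
  rw [(hg y).deriv]
  exact hneg y hy

/-- A differentiable function on the line that is strictly decreasing on `[0, ∞)` and tends to `0`
at `+∞` is positive on `[0, ∞)`. -/
lemma pos_of_deriv_neg_of_tendsto_zero {g g' : ℝ → ℝ} (hg : ∀ x, HasDerivAt g (g' x) x)
    (hneg : ∀ x, 0 < x → g' x < 0) (hlim : Tendsto g atTop (𝓝 0)) {x : ℝ} (hx : 0 ≤ x) :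
    0 < g x := by
  have hanti := strictAntiOn_of_hasDerivAt_neg hg hneg
  have h1 : g (x + 1) < g x := hanti hx (by simp; linarith) (by linarith)
  have h2 : 0 ≤ g (x + 1) := by
    refine le_of_tendsto hlim ?_
    filter_upwards [eventually_ge_atTop (x + 1)] with y hy
    exact hanti.antitoneOn (by simp; linarith) (by simp; linarith) hy
  linarith

lemma gaussTail_pos {x : ℝ} (hx : 0 ≤ x) : 0 < gaussTail x :=
  pos_of_deriv_neg_of_tendsto_zero hasDerivAt_gaussTail
    (fun y _ => neg_neg_of_pos (gauss_pos y)) tendsto_gaussTail hx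

lemma hasDerivAt_mul_gaussTail (x : ℝ) :
    HasDerivAt (fun y => 2 * gauss y - y * gaussTail y) (-gaussTail x) x := by
  refine HasDerivAt.congr_deriv (((hasDerivAt_gauss x).const_mul 2).sub
    ((hasDerivAt_id x).mul (hasDerivAt_gaussTail x))) ?_
  simp; ring

/-- The Mills-ratio upper bound `x ∫ₓ^∞ e^(-s²/4) ds ≤ 2 e^(-x²/4)`: the difference of
`∫ₓ^∞ e^(-s²/4) ds` and `(2/x) e^(-x²/4)` is increasing and vanishes at infinity. -/
lemma mul_gaussTail_le {x : ℝ} (hx : 0 < x) : x * gaussTail x ≤ 2 * gauss x := by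
  have hderiv : ∀ y ∈ Ioi (0 : ℝ), HasDerivAt (fun y => gaussTail y - 2 * gauss y / y)
      (2 * gauss y / y ^ 2) y := by
    intro y hy
    have hy0 : y ≠ 0 := ne_of_gt hy
    refine HasDerivAt.congr_deriv ((hasDerivAt_gaussTail y).sub
      (((hasDerivAt_gauss y).const_mul 2).div (hasDerivAt_id y) hy0)) ?_
    simp; field_simp; ring
  have hmono : MonotoneOn (fun y => gaussTail y - 2 * gauss y / y) (Ioi 0) := by
    refine monotoneOn_of_hasDerivWithinAt_nonneg (convex_Ioi 0)
      (fun y hy => (hderiv y hy).continuousAt.continuousWithinAt)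
      (f' := fun y => 2 * gauss y / y ^ 2) (fun y hy => ?_) fun y hy => ?_
    · rw [interior_Ioi] at hy
      exact (hderiv y hy).hasDerivWithinAt
    · have := gauss_pos y
      positivity
  have hlim : Tendsto (fun y => gaussTail y - 2 * gauss y / y) atTop (𝓝 0) := by
    have := tendsto_gaussTail.sub ((tendsto_gauss.const_mul 2).mul tendsto_inv_atTop_zero)
    simpa [div_eq_mul_inv] using this
  have h0 : gaussTail x - 2 * gauss x / x ≤ 0 := by
    refine ge_of_tendsto hlim ?_
    filter_upwards [eventually_ge_atTop x] with y hy
    exact hmono hx (lt_of_lt_of_le hx hy) hy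
  have : gaussTail x ≤ 2 * gauss x / x := by linarith
  rw [le_div_iff₀ hx] at this
  linarith

lemma decaySol_eq (x : ℝ) :
    decaySol x = (evenSol x * gaussTail x - x * gauss x) / √Real.pi := by
  have := sqrt_pi_pos.ne'
  simp only [decaySol, oddSol, gaussTail]; field_simp; ring

lemma decaySol'_eq (x : ℝ) : decaySol' x = (x * gaussTail x - 2 * gauss x) / √Real.pi := by
  have := sqrt_pi_pos.ne'
  simp only [decaySol', oddSol', gaussTail]; field_simp; ring

lemma tendsto_mul_gauss : Tendsto (fun x => x * gauss x) atTop (𝓝 0) := by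
  have h := (Real.tendsto_pow_mul_exp_neg_atTop_nhds_zero 1).comp
    ((tendsto_pow_atTop (α := ℝ) two_ne_zero).atTop_div_const (show (0 : ℝ) < 4 by norm_num))
  have h4 : Tendsto (fun x : ℝ => 4 * (x ^ 2 / 4 * gauss x)) atTop (𝓝 0) := by
    simpa [Function.comp_def, gauss] using h.const_mul 4
  refine squeeze_zero' ?_ ?_ h4
  · filter_upwards [eventually_ge_atTop 0] with x hx
    exact mul_nonneg hx (gauss_pos x).le
  · filter_upwards [eventually_ge_atTop 1] with x hx
    have := gauss_pos x
    nlinarith [mul_nonneg (mul_nonneg (by linarith : 0 ≤ x) this.le) (by linarith : 0 ≤ x - 1)]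

lemma tendsto_mul_gaussTail : Tendsto (fun x => x * gaussTail x) atTop (𝓝 0) := by
  refine squeeze_zero' ?_ ?_ (by simpa using tendsto_gauss.const_mul 2)
  · filter_upwards [eventually_ge_atTop 0] with x hx
    exact mul_nonneg hx (gaussTail_pos hx).le
  · filter_upwards [eventually_gt_atTop 0] with x hx using mul_gaussTail_le hx

lemma decaySol'_neg {x : ℝ} (hx : 0 ≤ x) : decaySol' x < 0 := by
  have h : 0 < 2 * gauss x - x * gaussTail x := by
    refine pos_of_deriv_neg_of_tendsto_zero hasDerivAt_mul_gaussTail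
      (fun y hy => neg_neg_of_pos (gaussTail_pos hy.le)) ?_ hx
    simpa using (tendsto_gauss.const_mul 2).sub tendsto_mul_gaussTail
  rw [decaySol'_eq]
  exact div_neg_of_neg_of_pos (by linarith) sqrt_pi_pos

lemma tendsto_decaySol : Tendsto decaySol atTop (𝓝 0) := by
  have hq : Tendsto (fun x => evenSol x * gaussTail x) atTop (𝓝 0) := by
    refine squeeze_zero' ?_ ?_ (by simpa using tendsto_gaussTail.add tendsto_mul_gauss)
    · filter_upwards [eventually_ge_atTop 0] with x hx
      have := gaussTail_pos hx
      unfold evenSol; positivity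
    · filter_upwards [eventually_gt_atTop 0] with x hx
      have := mul_gaussTail_le hx
      unfold evenSol; nlinarith
  have h := (hq.sub tendsto_mul_gauss).div_const (√Real.pi)
  simp only [sub_zero, zero_div] at h
  exact h.congr fun x => (decaySol_eq x).symm

lemma decaySol_pos {x : ℝ} (hx : 0 ≤ x) : 0 < decaySol x :=
  pos_of_deriv_neg_of_tendsto_zero hasDerivAt_decaySol (fun _ hy => decaySol'_neg hy.le)
    tendsto_decaySol hx

lemma decaySol_antitoneOn : AntitoneOn decaySol (Ici 0) := by
  refine antitoneOn_of_hasDerivWithinAt_nonpos (convex_Ici 0) continuous_decaySol.continuousOn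
    (fun x _ => (hasDerivAt_decaySol x).hasDerivWithinAt) fun x hx => ?_
  rw [interior_Ici] at hx
  exact (decaySol'_neg (le_of_lt hx)).le

/-- From the Mills-ratio upper bound. -/
lemma weight_mul_decaySol_le {x : ℝ} (hx : 0 < x) :
    weight x * decaySol x ≤ 2 / √Real.pi / x := by
  have h1 : weight x * (x * gaussTail x) ≤ 2 := by
    have := mul_le_mul_of_nonneg_left (mul_gaussTail_le hx) (weight_pos x).le
    have h2 := weight_mul_gauss x
    linarith
  have h2 : weight x * decaySol x = (evenSol x * (weight x * gaussTail x) - x) / √Real.pi := by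
    rw [decaySol_eq]
    have := weight_mul_gauss x
    rw [← mul_div_assoc]
    congr 1
    linear_combination (-x) * this
  have h3 : weight x * gaussTail x ≤ 2 / x := by
    rw [le_div_iff₀ hx]; linarith
  rw [h2, div_div, mul_comm (√Real.pi), ← div_div]
  refine div_le_div_of_nonneg_right ?_ sqrt_pi_pos.le
  have : evenSol x * (weight x * gaussTail x) ≤ evenSol x * (2 / x) :=
    mul_le_mul_of_nonneg_left h3 (by unfold evenSol; positivity)
  have h5 : evenSol x * (2 / x) - x = 2 / x := by unfold evenSol; field_simp; ring
  linarith

lemma tendsto_weight_mul_decaySol : Tendsto (fun x => weight x * decaySol x) atTop (𝓝 0) := by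
  refine squeeze_zero' ?_ ?_ (tendsto_const_nhds.div_atTop tendsto_id (a := 2 / √Real.pi))
  · filter_upwards [eventually_ge_atTop 0] with x hx
    exact mul_nonneg (weight_pos x).le (decaySol_pos hx).le
  · filter_upwards [eventually_gt_atTop 0] with x hx using weight_mul_decaySol_le hx

/-- Positivity of `decaySol` is the lower Mills-ratio bound, which makes `weight * decaySol'`
small. -/
lemma tendsto_weight_mul_decaySol' : Tendsto (fun x => weight x * decaySol' x) atTop (𝓝 0) := by
  have hlow : Tendsto (fun x : ℝ => -(2 / √Real.pi / evenSol x)) atTop (𝓝 0) := by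
    have hq : Tendsto evenSol atTop atTop :=
      tendsto_atTop_add_const_left _ _
        ((tendsto_pow_atTop (α := ℝ) two_ne_zero).atTop_div_const (by norm_num))
    simpa using (tendsto_const_nhds.div_atTop hq (a := 2 / √Real.pi)).neg
  refine tendsto_of_tendsto_of_tendsto_of_le_of_le' hlow tendsto_const_nhds ?_ ?_
  · filter_upwards [eventually_ge_atTop 0] with x hx
    have hD := decaySol_pos hx
    rw [decaySol_eq, div_pos_iff_of_pos_right sqrt_pi_pos] at hD
    have hq : 0 < evenSol x := by unfold evenSol; positivity
    have key : -2 / evenSol x ≤ weight x * (x * gaussTail x - 2 * gauss x) := by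
      rw [div_le_iff₀ hq]
      have h1 : 0 ≤ x * weight x * (evenSol x * gaussTail x - x * gauss x) :=
        mul_nonneg (mul_nonneg hx (weight_pos x).le) hD.le
      have h2 := weight_mul_gauss x
      have h3 : weight x * (x * gaussTail x - 2 * gauss x) * evenSol x =
          x * weight x * (evenSol x * gaussTail x - x * gauss x) - 2 := by
        have h4 : x ^ 2 - 2 * evenSol x = -2 := by unfold evenSol; ring
        linear_combination (x ^ 2 - 2 * evenSol x) * h2 + h4
      rw [h3]; linarith
    rw [decaySol'_eq, ← mul_div_assoc]
    have := div_le_div_of_nonneg_right key sqrt_pi_pos.le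
    refine le_trans (le_of_eq ?_) this
    have := sqrt_pi_pos.ne'
    field_simp
  · filter_upwards [eventually_ge_atTop 0] with x hx
    exact mul_nonpos_of_nonneg_of_nonpos (weight_pos x).le (decaySol'_neg hx).le

lemma decaySol_mul_weight_nonneg {x : ℝ} (hx : 0 ≤ x) : 0 ≤ decaySol x * weight x :=
  mul_nonneg (decaySol_pos hx).le (weight_pos x).le

lemma integrableOn_decaySol_mul_weight {x : ℝ} (hx : 0 ≤ x) :
    IntegrableOn (fun s => decaySol s * weight s) (Ioi x) :=
  integrableOn_Ioi_deriv_of_nonneg' (fun s _ => hasDerivAt_weight_mul_decaySol' s)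
    (fun _ hs => decaySol_mul_weight_nonneg (hx.trans (le_of_lt hs))) tendsto_weight_mul_decaySol'

lemma integral_decaySol_mul_weight {x : ℝ} (hx : 0 ≤ x) :
    ∫ s in Ioi x, decaySol s * weight s = -(weight x * decaySol' x) := by
  rw [integral_Ioi_of_hasDerivAt_of_nonneg' (fun s _ => hasDerivAt_weight_mul_decaySol' s)
    (fun _ hs => decaySol_mul_weight_nonneg (hx.trans (le_of_lt hs))) tendsto_weight_mul_decaySol']
  ring

lemma integral_oddSol_mul_weight (x : ℝ) :
    ∫ s in (0 : ℝ)..x, oddSol s * weight s = weight x * oddSol' x - 1 := by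
  rw [intervalIntegral.integral_eq_sub_of_hasDerivAt
    (fun s _ => hasDerivAt_weight_mul_oddSol' s)
    ((continuous_oddSol.mul continuous_weight).intervalIntegrable _ _)]
  simp [weight_zero, oddSol'_zero]

/-! ### The Green operator of `h ↦ h'' + (x/2) h' - h` -/

/-- The bounded solution of `h'' + (x/2) h' - h = -F` on `[0, ∞)` with `h(0) = 0`, written by
variation of constants with `evenSol` and `oddSol`, so that the formula makes sense on the whole
line and visibly gives an odd function when `F` is odd. -/
noncomputable def greenOp (F : ℝ → ℝ) (x : ℝ) : ℝ :=
  (∫ s in Ioi (0 : ℝ), decaySol s * weight s * F s) * oddSol x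
    - oddSol x * (∫ s in (0 : ℝ)..x, evenSol s * weight s * F s)
    + evenSol x * ∫ s in (0 : ℝ)..x, oddSol s * weight s * F s

/-- The derivative of `greenOp F` for continuous `F`. -/
noncomputable def greenOp' (F : ℝ → ℝ) (x : ℝ) : ℝ :=
  (∫ s in Ioi (0 : ℝ), decaySol s * weight s * F s) * oddSol' x
    - oddSol' x * (∫ s in (0 : ℝ)..x, evenSol s * weight s * F s)
    + x * ∫ s in (0 : ℝ)..x, oddSol s * weight s * F s

section Bounded

variable {F : ℝ → ℝ} {C : ℝ}

lemma intervalIntegrable_mul_of_bounded {g : ℝ → ℝ} (hg : Continuous g) (hF : Measurable F)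
    (hb : ∀ s, |F s| ≤ C) (a b : ℝ) : IntervalIntegrable (fun s => g s * F s) volume a b := by
  rw [intervalIntegrable_iff]
  exact (intervalIntegrable_iff.1 (hg.intervalIntegrable a b)).mul_bdd hF.aestronglyMeasurable
    (ae_of_all _ hb)

lemma integrableOn_decaySol_mul_of_bounded (hF : Measurable F) (hb : ∀ s, |F s| ≤ C) {x : ℝ}
    (hx : 0 ≤ x) : IntegrableOn (fun s => decaySol s * weight s * F s) (Ioi x) :=
  (integrableOn_decaySol_mul_weight hx).mul_bdd hF.aestronglyMeasurable (ae_of_all _ hb)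

lemma continuous_decaySol_mul_weight : Continuous fun s => decaySol s * weight s :=
  continuous_decaySol.mul continuous_weight

lemma continuous_oddSol_mul_weight : Continuous fun s => oddSol s * weight s :=
  continuous_oddSol.mul continuous_weight

lemma continuous_evenSol_mul_weight : Continuous fun s => evenSol s * weight s :=
  continuous_evenSol.mul continuous_weight

lemma continuous_greenOp (hF : Measurable F) (hb : ∀ s, |F s| ≤ C) : Continuous (greenOp F) := by
  have h1 := intervalIntegral.continuous_primitive
    (intervalIntegrable_mul_of_bounded continuous_evenSol_mul_weight hF hb) 0
  have h2 := intervalIntegral.continuous_primitive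
    (intervalIntegrable_mul_of_bounded continuous_oddSol_mul_weight hF hb) 0
  exact ((continuous_oddSol.const_mul _).sub (continuous_oddSol.mul h1)).add
    (continuous_evenSol.mul h2)

lemma greenOp_zero : greenOp F 0 = 0 := by simp [greenOp, oddSol_zero]

lemma greenOp_odd (hodd : ∀ s, F (-s) = -F s) (x : ℝ) : greenOp F (-x) = -greenOp F x := by
  have h1 : ∫ s in (0 : ℝ)..(-x), evenSol s * weight s * F s =
      ∫ s in (0 : ℝ)..x, evenSol s * weight s * F s := by
    have h := intervalIntegral.integral_comp_neg (a := 0) (b := x)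
      fun s => evenSol s * weight s * F s
    simp only [evenSol_neg, weight_neg, hodd, neg_zero, mul_neg,
      intervalIntegral.integral_neg] at h
    rw [intervalIntegral.integral_symm, ← h, neg_neg]
  have h2 : ∫ s in (0 : ℝ)..(-x), oddSol s * weight s * F s =
      -∫ s in (0 : ℝ)..x, oddSol s * weight s * F s := by
    have h := intervalIntegral.integral_comp_neg (a := 0) (b := x)
      fun s => oddSol s * weight s * F s
    simp only [oddSol_neg, weight_neg, hodd, neg_zero, mul_neg, neg_mul, neg_neg] at h
    rw [intervalIntegral.integral_symm, ← h]
  simp only [greenOp, h1, h2, oddSol_neg, evenSol_neg]; ring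

/-- Since `decaySol = evenSol - (2/√π) oddSol`, the integrals in `greenOp` and `greenOp'` regroup
into the ones of the Green function. -/
lemma integral_regroup (hF : Measurable F) (hb : ∀ s, |F s| ≤ C) {x : ℝ} (hx : 0 ≤ x) :
    (∫ s in Ioi (0 : ℝ), decaySol s * weight s * F s) -
        ∫ s in (0 : ℝ)..x, evenSol s * weight s * F s =
      (∫ s in Ioi x, decaySol s * weight s * F s) -
        2 / √Real.pi * ∫ s in (0 : ℝ)..x, oddSol s * weight s * F s := by
  rw [← intervalIntegral.integral_interval_add_Ioi
    (integrableOn_decaySol_mul_of_bounded hF hb le_rfl)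
    (integrableOn_decaySol_mul_of_bounded hF hb hx)]
  have h : ∫ s in (0 : ℝ)..x, decaySol s * weight s * F s =
      (∫ s in (0 : ℝ)..x, evenSol s * weight s * F s) -
        2 / √Real.pi * ∫ s in (0 : ℝ)..x, oddSol s * weight s * F s := by
    rw [← intervalIntegral.integral_const_mul, ← intervalIntegral.integral_sub
      (intervalIntegrable_mul_of_bounded continuous_evenSol_mul_weight hF hb _ _)
      ((intervalIntegrable_mul_of_bounded continuous_oddSol_mul_weight hF hb _ _).const_mul _)]
    congr 1
    ext s
    simp only [decaySol]; ring
  rw [h]; ring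

lemma greenOp_eq (hF : Measurable F) (hb : ∀ s, |F s| ≤ C) {x : ℝ} (hx : 0 ≤ x) :
    greenOp F x = oddSol x * (∫ s in Ioi x, decaySol s * weight s * F s) +
      decaySol x * ∫ s in (0 : ℝ)..x, oddSol s * weight s * F s := by
  have hD : decaySol x = evenSol x - 2 / √Real.pi * oddSol x := rfl
  rw [hD, greenOp]
  linear_combination (oddSol x) * integral_regroup hF hb hx

lemma greenOp'_eq (hF : Measurable F) (hb : ∀ s, |F s| ≤ C) {x : ℝ} (hx : 0 ≤ x) :
    greenOp' F x = oddSol' x * (∫ s in Ioi x, decaySol s * weight s * F s) +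
      decaySol' x * ∫ s in (0 : ℝ)..x, oddSol s * weight s * F s := by
  have hD : decaySol' x = x - 2 / √Real.pi * oddSol' x := rfl
  rw [hD, greenOp']
  linear_combination (oddSol' x) * integral_regroup hF hb hx

lemma hasDerivAt_greenOp (hF : Continuous F) (x : ℝ) :
    HasDerivAt (greenOp F) (greenOp' F x) x := by
  have h1 := (continuous_evenSol_mul_weight.mul hF).integral_hasStrictDerivAt 0 x |>.hasDerivAt
  have h2 := (continuous_oddSol_mul_weight.mul hF).integral_hasStrictDerivAt 0 x |>.hasDerivAt
  refine HasDerivAt.congr_deriv ((((hasDerivAt_oddSol x).const_mul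
    (∫ s in Ioi (0 : ℝ), decaySol s * weight s * F s)).sub ((hasDerivAt_oddSol x).mul h1)).add
    ((hasDerivAt_evenSol x).mul h2)) ?_
  simp only [greenOp', Pi.mul_apply]; ring

lemma hasDerivAt_greenOp' (hF : Continuous F) (x : ℝ) :
    HasDerivAt (greenOp' F) (greenOp F x - x / 2 * greenOp' F x - F x) x := by
  have h1 := (continuous_evenSol_mul_weight.mul hF).integral_hasStrictDerivAt 0 x |>.hasDerivAt
  have h2 := (continuous_oddSol_mul_weight.mul hF).integral_hasStrictDerivAt 0 x |>.hasDerivAt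
  refine HasDerivAt.congr_deriv ((((hasDerivAt_oddSol' x).const_mul
    (∫ s in Ioi (0 : ℝ), decaySol s * weight s * F s)).sub ((hasDerivAt_oddSol' x).mul h1)).add
    ((hasDerivAt_id x).mul h2)) ?_
  simp only [greenOp', greenOp, id, Pi.mul_apply]
  have h3 : evenSol x = 1 + x ^ 2 / 2 := rfl
  linear_combination (-F x) * wronskian_even_odd x -
    (∫ s in (0 : ℝ)..x, oddSol s * weight s * F s) * h3

/-- Positivity of the Green function. -/
lemma greenOp_mono {F₁ F₂ : ℝ → ℝ} {C₁ C₂ : ℝ} (hF₁ : Measurable F₁) (hb₁ : ∀ s, |F₁ s| ≤ C₁)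
    (hF₂ : Measurable F₂) (hb₂ : ∀ s, |F₂ s| ≤ C₂) (h : ∀ s, 0 < s → F₁ s ≤ F₂ s) {x : ℝ}
    (hx : 0 ≤ x) : greenOp F₁ x ≤ greenOp F₂ x := by
  rw [greenOp_eq hF₁ hb₁ hx, greenOp_eq hF₂ hb₂ hx]
  refine add_le_add (mul_le_mul_of_nonneg_left ?_ (oddSol_nonneg hx))
    (mul_le_mul_of_nonneg_left ?_ (decaySol_pos hx).le)
  · refine setIntegral_mono_on (integrableOn_decaySol_mul_of_bounded hF₁ hb₁ hx)
      (integrableOn_decaySol_mul_of_bounded hF₂ hb₂ hx) measurableSet_Ioi fun s hs => ?_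
    have hs0 : 0 < s := lt_of_le_of_lt hx hs
    exact mul_le_mul_of_nonneg_left (h s hs0) (decaySol_mul_weight_nonneg hs0.le)
  · refine intervalIntegral.integral_mono_on_of_le_Ioo hx
      (intervalIntegrable_mul_of_bounded continuous_oddSol_mul_weight hF₁ hb₁ _ _)
      (intervalIntegrable_mul_of_bounded continuous_oddSol_mul_weight hF₂ hb₂ _ _) fun s hs => ?_
    exact mul_le_mul_of_nonneg_left (h s hs.1)
      (mul_nonneg (oddSol_nonneg hs.1.le) (weight_pos s).le)

lemma greenOp_const (c : ℝ) {x : ℝ} (hx : 0 ≤ x) :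
    greenOp (fun _ => c) x = c * (1 - decaySol x) := by
  rw [greenOp_eq measurable_const (fun _ => le_rfl) hx, integral_mul_const,
    intervalIntegral.integral_mul_const, integral_decaySol_mul_weight hx,
    integral_oddSol_mul_weight]
  linear_combination c * wronskian_decay_odd x

lemma greenOp_const_mul (c x : ℝ) : greenOp (fun s => c * F s) x = c * greenOp F x := by
  simp only [greenOp, mul_left_comm _ c, integral_const_mul,
    intervalIntegral.integral_const_mul]
  ring

/-- For monotone `F`, the values of `F` on `(x, ∞)` and `(0, x)` are compared with `F x`; what
remains is `F x` times the derivative `-decaySol'` of `greenOp 1`. -/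
lemma neg_mul_decaySol'_le_greenOp' (hF : Measurable F) (hb : ∀ s, |F s| ≤ C)
    (hmono : MonotoneOn F (Ici 0)) {x : ℝ} (hx : 0 ≤ x) :
    F x * (-decaySol' x) ≤ greenOp' F x := by
  rw [greenOp'_eq hF hb hx]
  have h1 : -(weight x * decaySol' x) * F x ≤ ∫ s in Ioi x, decaySol s * weight s * F s := by
    rw [← integral_decaySol_mul_weight hx, ← integral_mul_const]
    refine setIntegral_mono_on ((integrableOn_decaySol_mul_weight hx).mul_const _)
      (integrableOn_decaySol_mul_of_bounded hF hb hx) measurableSet_Ioi fun s hs => ?_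
    have hs0 : 0 ≤ s := hx.trans (le_of_lt hs)
    exact mul_le_mul_of_nonneg_left (hmono hx hs0 (le_of_lt hs)) (decaySol_mul_weight_nonneg hs0)
  have h2 : ∫ s in (0 : ℝ)..x, oddSol s * weight s * F s ≤ (weight x * oddSol' x - 1) * F x := by
    rw [← integral_oddSol_mul_weight, ← intervalIntegral.integral_mul_const]
    refine intervalIntegral.integral_mono_on hx
      (intervalIntegrable_mul_of_bounded continuous_oddSol_mul_weight hF hb _ _)
      ((continuous_oddSol_mul_weight.intervalIntegrable _ _).mul_const _) fun s hs => ?_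
    exact mul_le_mul_of_nonneg_left (hmono hs.1 hx hs.2)
      (mul_nonneg (oddSol_nonneg hs.1) (weight_pos s).le)
  have h3 := mul_le_mul_of_nonneg_left h1 (oddSol'_pos hx).le
  have h4 := mul_le_mul_of_nonpos_left h2 (decaySol'_neg hx).le
  linarith

lemma greenOp_monotoneOn (hF : Continuous F) (hb : ∀ s, |F s| ≤ C)
    (hmono : MonotoneOn F (Ici 0)) (hpos : ∀ s, 0 ≤ s → 0 ≤ F s) :
    MonotoneOn (greenOp F) (Ici 0) := by
  refine monotoneOn_of_hasDerivWithinAt_nonneg (convex_Ici 0)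
    (fun x _ => (hasDerivAt_greenOp hF x).continuousAt.continuousWithinAt)
    (fun x _ => (hasDerivAt_greenOp hF x).hasDerivWithinAt) fun x hx => ?_
  rw [interior_Ici] at hx
  have hx0 : 0 ≤ x := le_of_lt hx
  exact (mul_nonneg (hpos x hx0) (by linarith [decaySol'_neg hx0])).trans
    (neg_mul_decaySol'_le_greenOp' hF.measurable hb hmono hx0)

lemma tendsto_greenOp {G : ℕ → ℝ → ℝ} (hG : ∀ n, Measurable (G n)) (hb : ∀ n s, |G n s| ≤ C)
    (hlim : ∀ s, Tendsto (fun n => G n s) atTop (𝓝 (F s))) (x : ℝ) :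
    Tendsto (fun n => greenOp (G n) x) atTop (𝓝 (greenOp F x)) := by
  have hint {g : ℝ → ℝ} (hg : Continuous g) :
      Tendsto (fun n => ∫ s in (0 : ℝ)..x, g s * G n s) atTop
        (𝓝 (∫ s in (0 : ℝ)..x, g s * F s)) := by
    refine intervalIntegral.tendsto_integral_filter_of_dominated_convergence
      (fun s => |g s| * C) (Eventually.of_forall fun n => ?_) (Eventually.of_forall fun n => ?_)
      ((hg.abs.intervalIntegrable _ _).mul_const _) ?_
    · exact (hg.measurable.mul (hG n)).aestronglyMeasurable
    · refine ae_of_all _ fun s _ => ?_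
      rw [Real.norm_eq_abs, abs_mul]
      exact mul_le_mul_of_nonneg_left (hb n s) (abs_nonneg _)
    · exact ae_of_all _ fun s _ => (hlim s).const_mul _
  have h0 : Tendsto (fun n => ∫ s in Ioi (0 : ℝ), decaySol s * weight s * G n s) atTop
      (𝓝 (∫ s in Ioi (0 : ℝ), decaySol s * weight s * F s)) := by
    refine tendsto_integral_of_dominated_convergence (fun s => decaySol s * weight s * C)
      (fun n => (continuous_decaySol_mul_weight.measurable.mul (hG n)).aestronglyMeasurable)
      ((integrableOn_decaySol_mul_weight le_rfl).mul_const _) (fun n => ?_)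
      (ae_of_all _ fun s => (hlim s).const_mul _)
    refine (ae_restrict_mem measurableSet_Ioi).mono fun s hs => ?_
    have := decaySol_mul_weight_nonneg (le_of_lt hs)
    rw [Real.norm_eq_abs, abs_mul, abs_of_nonneg this]
    exact mul_le_mul_of_nonneg_left (hb n s) this
  exact ((h0.mul_const _).sub ((hint continuous_evenSol_mul_weight).const_mul _)).add
    ((hint continuous_oddSol_mul_weight).const_mul _)

lemma measurable_indicator_Icc : Measurable (indicator (Icc (1 : ℝ) 2) (1 : ℝ → ℝ)) :=
  measurable_one.indicator measurableSet_Icc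

lemma indicator_Icc_nonneg (s : ℝ) : 0 ≤ indicator (Icc (1 : ℝ) 2) (1 : ℝ → ℝ) s :=
  indicator_nonneg (fun _ _ => zero_le_one) s

lemma abs_indicator_Icc_le (s : ℝ) : |indicator (Icc (1 : ℝ) 2) (1 : ℝ → ℝ) s| ≤ 1 := by
  rw [abs_of_nonneg (indicator_Icc_nonneg s)]
  exact indicator_le_self' (fun _ _ => zero_le_one) s

/-- Both parts of the Green function are bounded below by `decaySol 2 * oddSol 1` on the square
`[1, 2]²`. -/
lemma le_greenOp_indicator {x : ℝ} (hx : x ∈ Icc (1 : ℝ) 2) :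
    decaySol 2 * oddSol 1 ≤ greenOp (indicator (Icc 1 2) 1) x := by
  have hx0 : (0 : ℝ) ≤ x := by linarith [hx.1]
  have hF := measurable_indicator_Icc
  have hF0 := indicator_Icc_nonneg
  have hb := abs_indicator_Icc_le
  rw [greenOp_eq hF hb hx0]
  have hD2 := decaySol_pos (show (0 : ℝ) ≤ 2 by norm_num)
  have hU1 := oddSol_pos (zero_lt_one' ℝ)
  have hDx : decaySol 2 ≤ decaySol x := decaySol_antitoneOn hx0 (by simp) hx.2
  have hUx : oddSol 1 ≤ oddSol x := oddSol_monotoneOn (by simp) hx0 hx.1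
  have h1 : (2 - x) * decaySol 2 ≤
      ∫ s in Ioi x, decaySol s * weight s * indicator (Icc (1 : ℝ) 2) (1 : ℝ → ℝ) s := by
    have hle : ∫ s in Ioc x 2, decaySol s * weight s * indicator (Icc (1 : ℝ) 2) (1 : ℝ → ℝ) s ≤
        ∫ s in Ioi x, decaySol s * weight s * indicator (Icc (1 : ℝ) 2) (1 : ℝ → ℝ) s := by
      refine setIntegral_mono_set (integrableOn_decaySol_mul_of_bounded hF hb hx0) ?_
        Ioc_subset_Ioi_self.eventuallyLE
      refine (ae_restrict_mem measurableSet_Ioi).mono fun s hs => ?_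
      exact mul_nonneg (decaySol_mul_weight_nonneg (hx0.trans (le_of_lt hs))) (hF0 s)
    refine le_trans ?_ hle
    rw [← intervalIntegral.integral_of_le hx.2, ← smul_eq_mul,
      ← intervalIntegral.integral_const]
    refine intervalIntegral.integral_mono_on hx.2 (by simp)
      (intervalIntegrable_mul_of_bounded continuous_decaySol_mul_weight hF hb _ _) fun s hs => ?_
    rw [indicator_of_mem (show s ∈ Icc (1 : ℝ) 2 from ⟨hx.1.trans hs.1, hs.2⟩), Pi.one_apply,
      mul_one]
    have : decaySol 2 ≤ decaySol s := decaySol_antitoneOn (hx0.trans hs.1) (by simp) hs.2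
    nlinarith [one_le_weight s]
  have h2 : (x - 1) * oddSol 1 ≤
      ∫ s in (0 : ℝ)..x, oddSol s * weight s * indicator (Icc (1 : ℝ) 2) (1 : ℝ → ℝ) s := by
    have hint := intervalIntegrable_mul_of_bounded continuous_oddSol_mul_weight hF hb
    rw [← intervalIntegral.integral_add_adjacent_intervals (hint 0 1) (hint 1 x)]
    have h3 : 0 ≤ ∫ s in (0 : ℝ)..1,
        oddSol s * weight s * indicator (Icc (1 : ℝ) 2) (1 : ℝ → ℝ) s :=
      intervalIntegral.integral_nonneg zero_le_one fun s hs =>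
        mul_nonneg (mul_nonneg (oddSol_nonneg hs.1) (weight_pos s).le) (hF0 s)
    have h4 : (x - 1) * oddSol 1 ≤ ∫ s in (1 : ℝ)..x,
        oddSol s * weight s * indicator (Icc (1 : ℝ) 2) (1 : ℝ → ℝ) s := by
      rw [← smul_eq_mul, ← intervalIntegral.integral_const]
      refine intervalIntegral.integral_mono_on hx.1 (by simp) (hint _ _) fun s hs => ?_
      rw [indicator_of_mem (show s ∈ Icc (1 : ℝ) 2 from ⟨hs.1, hs.2.trans hx.2⟩), Pi.one_apply,
        mul_one]
      have : oddSol 1 ≤ oddSol s :=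
        oddSol_monotoneOn (by simp) (show (0 : ℝ) ≤ s by linarith [hs.1]) hs.1
      nlinarith [one_le_weight s]
    linarith
  have h5 : oddSol 1 * ((2 - x) * decaySol 2) ≤ oddSol x * ∫ s in Ioi x,
      decaySol s * weight s * indicator (Icc (1 : ℝ) 2) (1 : ℝ → ℝ) s :=
    mul_le_mul hUx h1 (mul_nonneg (by linarith [hx.2]) hD2.le) (hU1.le.trans hUx)
  have h6 : decaySol 2 * ((x - 1) * oddSol 1) ≤ decaySol x * ∫ s in (0 : ℝ)..x,
      oddSol s * weight s * indicator (Icc (1 : ℝ) 2) (1 : ℝ → ℝ) s :=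
    mul_le_mul hDx h2 (mul_nonneg (by linarith [hx.1]) hU1.le) (hD2.le.trans hDx)
  linarith

end Bounded

/-! ### The nonlinearity -/

/-- The nonlinearity `f_p(u) - (p/(1-p)) u`, for which the profile equation reads
`w'' + (x/2) w' - w = -source p w`. -/
noncomputable def source (p u : ℝ) : ℝ := fNonlin p u - p / (1 - p) * u

section Nonlinearity

variable {p : ℝ}

lemma fNonlin_of_nonneg (hp : 0 < p) {u : ℝ} (hu : 0 ≤ u) : fNonlin p u = u ^ p := by
  rcases hu.eq_or_lt with rfl | hu'
  · simp [fNonlin, hp.ne']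
  · rw [fNonlin, abs_of_pos hu', Real.rpow_sub_one hu'.ne', mul_div_cancel₀ _ hu'.ne']

lemma fNonlin_neg (p u : ℝ) : fNonlin p (-u) = -fNonlin p u := by simp [fNonlin]

lemma abs_fNonlin (hp : 0 < p) (u : ℝ) : |fNonlin p u| = |u| ^ p := by
  rcases le_total 0 u with hu | hu
  · rw [fNonlin_of_nonneg hp hu, abs_of_nonneg hu, abs_of_nonneg (Real.rpow_nonneg hu _)]
  · rw [← abs_neg, ← fNonlin_neg, fNonlin_of_nonneg hp (by linarith), abs_of_nonpos hu,
      abs_of_nonneg (Real.rpow_nonneg (by linarith) _)]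

lemma continuous_fNonlin (hp : 0 < p) : Continuous (fNonlin p) := by
  have h : fNonlin p = fun u => (max u 0) ^ p - (max (-u) 0) ^ p := by
    ext u
    rcases le_total 0 u with hu | hu
    · rw [fNonlin_of_nonneg hp hu, max_eq_left hu, max_eq_right (by linarith),
        Real.zero_rpow hp.ne', sub_zero]
    · rw [← neg_neg u, fNonlin_neg, fNonlin_of_nonneg hp (by linarith), neg_neg,
        max_eq_right hu, max_eq_left (by linarith), Real.zero_rpow hp.ne', zero_sub]
  rw [h]
  exact ((continuous_id.max continuous_const).rpow_const fun _ => Or.inr hp.le).sub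
    ((continuous_neg.max continuous_const).rpow_const fun _ => Or.inr hp.le)

lemma source_neg (p u : ℝ) : source p (-u) = -source p u := by
  simp [source, fNonlin_neg]; ring

lemma source_of_nonneg (hp : 0 < p) {u : ℝ} (hu : 0 ≤ u) :
    source p u = u ^ p - p / (1 - p) * u := by
  rw [source, fNonlin_of_nonneg hp hu]

lemma source_zero (hp : 0 < p) : source p 0 = 0 := by
  rw [source_of_nonneg hp le_rfl, Real.zero_rpow hp.ne']; simp

lemma continuous_source (hp : 0 < p) : Continuous (source p) :=
  (continuous_fNonlin hp).sub (continuous_const.mul continuous_id)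

lemma frontLimit_pos (hp1 : p < 1) : 0 < frontLimit p := Real.rpow_pos_of_pos (by linarith) _

lemma frontLimit_le_one (hp : 0 ≤ p) (hp1 : p < 1) : frontLimit p ≤ 1 := by
  have : 0 < 1 - p := by linarith
  exact Real.rpow_le_one this.le (by linarith) (by positivity)

lemma frontLimit_rpow_sub_one (hp1 : p < 1) : frontLimit p ^ (p - 1) = 1 / (1 - p) := by
  have h : 0 < 1 - p := by linarith
  rw [frontLimit, ← Real.rpow_mul h.le,
    show 1 / (1 - p) * (p - 1) = -1 by field_simp; ring, Real.rpow_neg_one, one_div]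

lemma frontLimit_rpow (hp1 : p < 1) : frontLimit p ^ p = frontLimit p / (1 - p) := by
  have hL := frontLimit_pos hp1
  have h := frontLimit_rpow_sub_one hp1
  rw [Real.rpow_sub_one hL.ne'] at h
  rw [div_eq_iff hL.ne'] at h
  rw [h]; ring

lemma source_frontLimit (hp : 0 < p) (hp1 : p < 1) : source p (frontLimit p) = frontLimit p := by
  have : 1 - p ≠ 0 := by linarith
  rw [source_of_nonneg hp (frontLimit_pos hp1).le, frontLimit_rpow hp1]
  field_simp

/-- The derivative of `source p` is `p (u^(p-1) - 1/(1-p))`, which is nonnegative exactly up to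
`frontLimit p`. -/
lemma source_monotoneOn (hp : 0 < p) (hp1 : p < 1) :
    MonotoneOn (source p) (Icc 0 (frontLimit p)) := by
  have hmono : MonotoneOn (fun u : ℝ => u ^ p - p / (1 - p) * u) (Icc 0 (frontLimit p)) := by
    refine monotoneOn_of_hasDerivWithinAt_nonneg (convex_Icc _ _)
      ((Real.continuous_rpow_const hp.le).sub (continuous_const.mul continuous_id)).continuousOn
      (f' := fun u => p * u ^ (p - 1) - p / (1 - p)) (fun u hu => ?_) fun u hu => ?_
    all_goals rw [interior_Icc] at hu
    · exact ((Real.hasDerivAt_rpow_const (Or.inl hu.1.ne')).sub (by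
        simpa using (hasDerivAt_id u).const_mul (p / (1 - p)))).hasDerivWithinAt
    · have h := Real.rpow_le_rpow_of_nonpos hu.1 hu.2.le (by linarith : p - 1 ≤ 0)
      rw [frontLimit_rpow_sub_one hp1] at h
      have := mul_le_mul_of_nonneg_left h hp.le
      rw [mul_one_div] at this
      linarith
  intro u hu v hv huv
  rw [source_of_nonneg hp hu.1, source_of_nonneg hp hv.1]
  exact hmono hu hv huv

lemma source_mem_Icc (hp : 0 < p) (hp1 : p < 1) {u : ℝ} (hu : u ∈ Icc 0 (frontLimit p)) :
    source p u ∈ Icc 0 (frontLimit p) := by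
  have hL := (frontLimit_pos hp1).le
  constructor
  · have h := source_monotoneOn hp hp1 ⟨le_rfl, hL⟩ hu hu.1
    rwa [source_zero hp] at h
  · have h := source_monotoneOn hp hp1 hu ⟨hL, le_rfl⟩ hu.2
    rwa [source_frontLimit hp hp1] at h

lemma mul_le_source_sub_self (hp : 0 < p) (hp1 : p < 1) {u l : ℝ} (hu : 0 < u) (hul : u ≤ l) :
    u * (l ^ (p - 1) - 1 / (1 - p)) ≤ source p u - u := by
  have h1 : u ^ p = u * u ^ (p - 1) := by
    rw [Real.rpow_sub_one hu.ne', mul_div_cancel₀ _ hu.ne']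
  have h2 := mul_le_mul_of_nonneg_left
    (Real.rpow_le_rpow_of_nonpos hu hul (by linarith : p - 1 ≤ 0)) hu.le
  have h3 : p / (1 - p) + 1 = 1 / (1 - p) := by
    have : 1 - p ≠ 0 := by linarith
    field_simp; ring
  rw [source_of_nonneg hp hu.le, h1]
  linear_combination h2 + u * h3

lemma one_div_lt_rpow_sub_one (hp1 : p < 1) {l : ℝ} (hl : 0 < l) (hlL : l < frontLimit p) :
    1 / (1 - p) < l ^ (p - 1) := by
  rw [← frontLimit_rpow_sub_one hp1]
  exact Real.rpow_lt_rpow_of_neg hl hlL (by linarith)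

lemma self_lt_source (hp : 0 < p) (hp1 : p < 1) {u : ℝ} (hu : 0 < u) (huL : u < frontLimit p) :
    u < source p u := by
  have h1 := mul_le_source_sub_self hp hp1 hu le_rfl
  have h2 := mul_pos hu (sub_pos.2 (one_div_lt_rpow_sub_one hp1 hu huL))
  linarith

lemma self_le_source (hp : 0 < p) (hp1 : p < 1) {u : ℝ} (hu : u ∈ Icc 0 (frontLimit p)) :
    u ≤ source p u := by
  rcases hu.1.eq_or_lt with rfl | h0
  · rw [source_zero hp]
  rcases hu.2.eq_or_lt with rfl | h1
  · rw [source_frontLimit hp hp1]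
  · exact (self_lt_source hp hp1 h0 h1).le

/-- Sublinearity of the exponent `p < 1` at the origin: `source p` dominates every linear
function on a small enough interval. -/
lemma exists_le_source_mul (hp : 0 < p) (hp1 : p < 1) {c : ℝ} (hc : 0 < c) :
    ∃ ε, 0 < ε ∧ ε ≤ frontLimit p ∧ ε * c ≤ frontLimit p ∧ ε ≤ source p (ε * c) := by
  have hL := frontLimit_pos hp1
  have hq : 0 < 1 - p := by linarith
  set K : ℝ := 1 / c + p / (1 - p) with hK
  have hKpos : 0 < K := by positivity
  set y : ℝ := min (min (frontLimit p) (c * frontLimit p)) (K ^ (1 / (p - 1))) with hy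
  have hypos : 0 < y := lt_min (lt_min hL (mul_pos hc hL)) (Real.rpow_pos_of_pos hKpos _)
  have hyc : y / c * c = y := div_mul_cancel₀ _ hc.ne'
  refine ⟨y / c, div_pos hypos hc, ?_, ?_, ?_⟩
  · rw [div_le_iff₀ hc, mul_comm]
    exact (min_le_left _ _).trans (min_le_right _ _)
  · rw [hyc]
    exact (min_le_left _ _).trans (min_le_left _ _)
  · rw [hyc, source_of_nonneg hp hypos.le]
    have h1 : K ≤ y ^ (p - 1) := by
      have h := Real.rpow_le_rpow_of_nonpos hypos (min_le_right _ _ : y ≤ K ^ (1 / (p - 1)))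
        (by linarith : p - 1 ≤ 0)
      rwa [← Real.rpow_mul hKpos.le, one_div_mul_cancel (by linarith), Real.rpow_one] at h
    have h2 : y ^ p = y * y ^ (p - 1) := by
      rw [Real.rpow_sub_one hypos.ne', mul_div_cancel₀ _ hypos.ne']
    have h3 := mul_le_mul_of_nonneg_left h1 hypos.le
    have h4 : y * K = y / c + p / (1 - p) * y := by rw [hK]; ring
    linarith

end Nonlinearity

/-! ### Monotone iteration -/

/-- The class of functions in which the iteration takes place: continuous and odd, and on
`[0, ∞)` monotone with values in `[0, L]`. -/
structure Admissible (L : ℝ) (v : ℝ → ℝ) : Prop where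
  continuous : Continuous v
  odd : ∀ s, v (-s) = -v s
  mem_Icc : ∀ s, 0 ≤ s → v s ∈ Icc 0 L
  monotoneOn : MonotoneOn v (Ici 0)

lemma abs_le_of_odd {L : ℝ} {v : ℝ → ℝ} (hodd : ∀ s, v (-s) = -v s)
    (hv : ∀ s, 0 ≤ s → v s ∈ Icc 0 L) (s : ℝ) : |v s| ≤ L := by
  rcases le_total 0 s with hs | hs
  · rw [abs_of_nonneg (hv s hs).1]; exact (hv s hs).2
  · have h := hv (-s) (by linarith)
    rw [hodd] at h
    rw [abs_of_nonpos (by linarith [h.1])]; exact h.2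

section Iteration

variable {p : ℝ} {v : ℝ → ℝ}

lemma abs_source_le (hp : 0 < p) (hp1 : p < 1) (hodd : ∀ s, v (-s) = -v s)
    (hv : ∀ s, 0 ≤ s → v s ∈ Icc 0 (frontLimit p)) (s : ℝ) :
    |source p (v s)| ≤ frontLimit p :=
  abs_le_of_odd (v := fun s => source p (v s)) (fun s => by rw [hodd, source_neg])
    (fun s hs => source_mem_Icc hp hp1 (hv s hs)) s

/-- The fixed-point operator, whose fixed points solve the profile equation. -/
noncomputable def profileOp (p : ℝ) (v : ℝ → ℝ) : ℝ → ℝ := greenOp fun s => source p (v s)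

lemma monotoneOn_source_comp (hp : 0 < p) (hp1 : p < 1)
    (hv : ∀ s, 0 ≤ s → v s ∈ Icc 0 (frontLimit p)) (hmono : MonotoneOn v (Ici 0)) :
    MonotoneOn (fun s => source p (v s)) (Ici 0) := fun a ha b hb hab =>
  source_monotoneOn hp hp1 (hv a ha) (hv b hb) (hmono ha hb hab)

lemma profileOp_le (hp : 0 < p) (hp1 : p < 1) (hmeas : Measurable v)
    (hodd : ∀ s, v (-s) = -v s) (hv : ∀ s, 0 ≤ s → v s ∈ Icc 0 (frontLimit p)) {x : ℝ}
    (hx : 0 ≤ x) : profileOp p v x ≤ frontLimit p * (1 - decaySol x) := by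
  rw [← greenOp_const _ hx]
  exact greenOp_mono ((continuous_source hp).measurable.comp hmeas)
    (abs_source_le hp hp1 hodd hv) measurable_const (fun _ => le_rfl)
    (fun s hs => (source_mem_Icc hp hp1 (hv s hs.le)).2) hx

lemma Admissible.profileOp (hp : 0 < p) (hp1 : p < 1) (h : Admissible (frontLimit p) v) :
    Admissible (frontLimit p) (profileOp p v) := by
  have hc : Continuous fun s => source p (v s) := (continuous_source hp).comp h.continuous
  have hb := abs_source_le hp hp1 h.odd h.mem_Icc
  have hmono := greenOp_monotoneOn hc hb (monotoneOn_source_comp hp hp1 h.mem_Icc h.monotoneOn)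
    fun s hs => (source_mem_Icc hp hp1 (h.mem_Icc s hs)).1
  refine ⟨continuous_greenOp hc.measurable hb,
    greenOp_odd fun s => by rw [h.odd, source_neg], fun s hs => ⟨?_, ?_⟩, hmono⟩
  · have h0 := hmono (le_refl (0 : ℝ)) hs hs
    rwa [greenOp_zero] at h0
  · have h1 := profileOp_le hp hp1 h.continuous.measurable h.odd h.mem_Icc hs
    nlinarith [decaySol_pos hs, frontLimit_pos hp1]

lemma profileOp_mono {w : ℝ → ℝ} (hp : 0 < p) (hp1 : p < 1) (hv : Admissible (frontLimit p) v)
    (hw : Admissible (frontLimit p) w) (hvw : ∀ s, 0 ≤ s → v s ≤ w s) {x : ℝ} (hx : 0 ≤ x) :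
    profileOp p v x ≤ profileOp p w x :=
  greenOp_mono ((continuous_source hp).comp hv.continuous).measurable
    (abs_source_le hp hp1 hv.odd hv.mem_Icc)
    ((continuous_source hp).comp hw.continuous).measurable
    (abs_source_le hp hp1 hw.odd hw.mem_Icc)
    (fun s hs => source_monotoneOn hp hp1 (hv.mem_Icc s hs.le) (hw.mem_Icc s hs.le)
      (hvw s hs.le)) hx

/-- The odd function that equals `L (1 - decaySol)` on `[0, ∞)`, the image under `greenOp` of the
constant supersolution `L` there. -/
noncomputable def upperStart (L : ℝ) : ℝ → ℝ := greenOp fun s => L * Real.sign s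

lemma measurable_mul_sign (L : ℝ) : Measurable fun s => L * Real.sign s :=
  measurable_const.mul <| Measurable.ite measurableSet_Iio measurable_const <|
    Measurable.ite measurableSet_Ioi measurable_const measurable_const

lemma abs_mul_sign_le {L : ℝ} (hL : 0 ≤ L) (s : ℝ) : |L * Real.sign s| ≤ L := by
  rcases Real.sign_apply_eq s with h | h | h <;> simp [h, abs_of_nonneg hL, hL]

lemma upperStart_eq {L : ℝ} (hL : 0 ≤ L) {x : ℝ} (hx : 0 ≤ x) :
    upperStart L x = L * (1 - decaySol x) := by
  have hs (s : ℝ) (hs : 0 < s) : L * Real.sign s = L := by rw [Real.sign_of_pos hs, mul_one]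
  rw [← greenOp_const L hx]
  exact le_antisymm
    (greenOp_mono (measurable_mul_sign L) (abs_mul_sign_le hL) measurable_const
      (fun _ => le_rfl) (fun s h => (hs s h).le) hx)
    (greenOp_mono measurable_const (fun _ => le_rfl) (measurable_mul_sign L) (abs_mul_sign_le hL)
      (fun s h => (hs s h).ge) hx)

lemma admissible_upperStart {L : ℝ} (hL : 0 ≤ L) : Admissible L (upperStart L) := by
  refine ⟨continuous_greenOp (measurable_mul_sign L) (abs_mul_sign_le hL),
    greenOp_odd fun s => ?_, fun s hs => ?_, fun a ha b hb hab => ?_⟩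
  · rw [Real.sign_neg]; ring
  · have h0 := decaySol_pos hs
    have h1 := decaySol_antitoneOn (le_refl (0 : ℝ)) hs hs
    rw [decaySol_zero] at h1
    rw [upperStart_eq hL hs]
    constructor <;> nlinarith
  · rw [upperStart_eq hL ha, upperStart_eq hL hb]
    exact mul_le_mul_of_nonneg_left (sub_le_sub_left (decaySol_antitoneOn ha hb hab) _) hL

/-- The monotone iteration of `profileOp p`, started from the supersolution. -/
noncomputable def profileIter (p : ℝ) : ℕ → ℝ → ℝ
  | 0 => upperStart (frontLimit p)
  | n + 1 => profileOp p (profileIter p n)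

lemma admissible_profileIter (hp : 0 < p) (hp1 : p < 1) (n : ℕ) :
    Admissible (frontLimit p) (profileIter p n) := by
  induction n with
  | zero => exact admissible_upperStart (frontLimit_pos hp1).le
  | succ n ih => exact ih.profileOp hp hp1

lemma profileIter_succ_le (hp : 0 < p) (hp1 : p < 1) (n : ℕ) {x : ℝ} (hx : 0 ≤ x) :
    profileIter p (n + 1) x ≤ profileIter p n x := by
  induction n generalizing x with
  | zero =>
    have h := admissible_profileIter hp hp1 0
    exact (profileOp_le hp hp1 h.continuous.measurable h.odd h.mem_Icc hx).trans
      (upperStart_eq (frontLimit_pos hp1).le hx).ge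
  | succ n ih =>
    exact profileOp_mono hp hp1 (admissible_profileIter hp hp1 (n + 1))
      (admissible_profileIter hp hp1 n) (fun s hs => ih hs) hx

/-- A small multiple of the solution with right-hand side the indicator of `[1, 2]` is a
subsolution: the sublinear nonlinearity reproduces a multiple of the indicator. -/
lemma exists_pos_le_profileIter (hp : 0 < p) (hp1 : p < 1) :
    ∃ δ, 0 < δ ∧ ∀ n, δ ≤ profileIter p n 1 := by
  have hc : 0 < decaySol 2 * oddSol 1 := mul_pos (decaySol_pos zero_le_two) (oddSol_pos one_pos)
  obtain ⟨ε, hε, hεL, hεc, hεs⟩ := exists_le_source_mul hp hp1 hc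
  set χ : ℝ → ℝ := indicator (Icc (1 : ℝ) 2) (1 : ℝ → ℝ) with hχ
  have hχm : Measurable fun s => ε * χ s := measurable_const.mul measurable_indicator_Icc
  have hχb (s : ℝ) : |ε * χ s| ≤ ε := by
    rw [abs_mul, abs_of_pos hε]
    exact mul_le_of_le_one_right hε.le (abs_indicator_Icc_le s)
  have hlow : ∀ n, ∀ x, 0 ≤ x → ε * greenOp χ x ≤ profileIter p n x := by
    intro n
    induction n with
    | zero =>
      intro x hx
      rw [← greenOp_const_mul, profileIter, upperStart_eq (frontLimit_pos hp1).le hx,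
        ← greenOp_const _ hx]
      exact greenOp_mono hχm hχb measurable_const (fun _ => le_rfl)
        (fun s _ => (le_abs_self _).trans ((hχb s).trans hεL)) hx
    | succ n ih =>
      intro x hx
      have hn := admissible_profileIter hp hp1 n
      rw [← greenOp_const_mul]
      refine greenOp_mono hχm hχb ((continuous_source hp).comp hn.continuous).measurable
        (abs_source_le hp hp1 hn.odd hn.mem_Icc) (fun s hs => ?_) hx
      by_cases hsI : s ∈ Icc (1 : ℝ) 2
      · rw [hχ, indicator_of_mem hsI, Pi.one_apply, mul_one]
        have h1 : ε * (decaySol 2 * oddSol 1) ≤ profileIter p n s :=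
          (mul_le_mul_of_nonneg_left (le_greenOp_indicator hsI) hε.le).trans (ih s hs.le)
        exact hεs.trans (source_monotoneOn hp hp1 ⟨by positivity, hεc⟩ (hn.mem_Icc s hs.le) h1)
      · rw [hχ, indicator_of_notMem hsI, mul_zero]
        exact (source_mem_Icc hp hp1 (hn.mem_Icc s hs.le)).1
  refine ⟨ε * (decaySol 2 * oddSol 1), by positivity, fun n => ?_⟩
  exact (mul_le_mul_of_nonneg_left (le_greenOp_indicator ⟨le_rfl, one_le_two⟩) hε.le).trans
    (hlow n 1 zero_le_one)

lemma exists_tendsto_profileIter (hp : 0 < p) (hp1 : p < 1) (s : ℝ) :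
    ∃ l, Tendsto (fun n => profileIter p n s) atTop (𝓝 l) := by
  have hpos (s : ℝ) (hs : 0 ≤ s) : ∃ l, Tendsto (fun n => profileIter p n s) atTop (𝓝 l) :=
    ⟨_, tendsto_atTop_ciInf (antitone_nat_of_succ_le fun n => profileIter_succ_le hp hp1 n hs)
      ⟨0, by rintro _ ⟨n, rfl⟩; exact ((admissible_profileIter hp hp1 n).mem_Icc s hs).1⟩⟩
  rcases le_total 0 s with hs | hs
  · exact hpos s hs
  · obtain ⟨l, hl⟩ := hpos (-s) (by linarith)
    refine ⟨-l, hl.neg.congr fun n => ?_⟩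
    rw [(admissible_profileIter hp hp1 n).odd, neg_neg]

lemma exists_fixedPoint_profileOp (hp : 0 < p) (hp1 : p < 1) :
    ∃ v, Admissible (frontLimit p) v ∧ profileOp p v = v ∧ 0 < v 1 := by
  choose v hv using exists_tendsto_profileIter hp hp1
  have hadm := admissible_profileIter hp hp1
  have hmeas : Measurable v :=
    measurable_of_tendsto_metrizable (fun n => (hadm n).continuous.measurable)
      (tendsto_pi_nhds.2 hv)
  have hodd (s : ℝ) : v (-s) = -v s :=
    tendsto_nhds_unique (hv (-s)) ((hv s).neg.congr fun n => ((hadm n).odd s).symm)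
  have hmem (s : ℝ) (hs : 0 ≤ s) : v s ∈ Icc 0 (frontLimit p) :=
    isClosed_Icc.mem_of_tendsto (hv s) (Eventually.of_forall fun n => (hadm n).mem_Icc s hs)
  have hmono : MonotoneOn v (Ici 0) := fun a ha b hb hab =>
    le_of_tendsto_of_tendsto' (hv a) (hv b) fun n => (hadm n).monotoneOn ha hb hab
  have hfix : profileOp p v = v := by
    ext x
    refine tendsto_nhds_unique ?_ ((hv x).comp (tendsto_add_atTop_nat 1))
    exact tendsto_greenOp (G := fun n s => source p (profileIter p n s))
      (fun n => ((continuous_source hp).comp (hadm n).continuous).measurable)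
      (fun n => abs_source_le hp hp1 (hadm n).odd (hadm n).mem_Icc)
      (fun s => ((continuous_source hp).tendsto _).comp (hv s)) x
  obtain ⟨δ, hδ, hle⟩ := exists_pos_le_profileIter hp hp1
  refine ⟨v, ⟨?_, hodd, hmem, hmono⟩, hfix, hδ.trans_le (ge_of_tendsto' (hv 1) hle)⟩
  rw [← hfix]
  exact continuous_greenOp ((continuous_source hp).measurable.comp hmeas)
    (abs_source_le hp hp1 hodd hmem)

end Iteration

/-! ### Fixed points are front profiles -/

/-- A function whose derivative is at most `-c < 0` cannot stay nonnegative. -/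
lemma not_forall_nonneg_of_hasDerivAt_le {g g' : ℝ → ℝ} {c : ℝ} (hc : 0 < c)
    (hg : ∀ x, HasDerivAt g (g' x) x) (hle : ∀ x, 1 < x → g' x ≤ -c) :
    ¬ ∀ x, 1 ≤ x → 0 ≤ g x := by
  intro hpos
  have hanti : AntitoneOn (fun x => g x + c * x) (Ici 1) := by
    refine antitoneOn_of_hasDerivWithinAt_nonpos (convex_Ici 1)
      (fun x _ => ((hg x).continuousAt.add (by fun_prop)).continuousWithinAt)
      (f' := fun x => g' x + c) (fun x _ => ?_) fun x hx => ?_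
    · exact ((hg x).add (by simpa using (hasDerivAt_id x).const_mul c)).hasDerivWithinAt
    · rw [interior_Ici] at hx
      linarith [hle x hx]
  have h1 := hpos 1 le_rfl
  have hx : 1 ≤ 1 + (g 1 + 1) / c := by
    have : 0 ≤ (g 1 + 1) / c := by positivity
    linarith
  have h2 : g (1 + (g 1 + 1) / c) + c * (1 + (g 1 + 1) / c) ≤ g 1 + c * 1 :=
    hanti (le_refl (1 : ℝ)) hx hx
  have h3 : c * ((g 1 + 1) / c) = g 1 + 1 := mul_div_cancel₀ _ hc.ne'
  linarith [hpos _ hx]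

/-- A nonzero fixed point of `profileOp p` is a front profile. Monotonicity is strict because
`weight * v'` is decreasing and positive far out; the limit at infinity is `frontLimit p`, because
below that value `source p u - u` is positive and would make `weight * v'` decrease linearly; and
the equation then gives concavity on `[0, ∞)`, from which the bounds on `v'` follow. -/
lemma isFrontProfile_of_fixedPoint {p : ℝ} (hp : 0 < p) (hp1 : p < 1) {v : ℝ → ℝ}
    (hadm : Admissible (frontLimit p) v) (hfix : profileOp p v = v) (hv1 : 0 < v 1) :
    IsFrontProfile p v := by
  set F : ℝ → ℝ := fun s => source p (v s) with hF
  set v' : ℝ → ℝ := greenOp' F with hv'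
  have hFc : Continuous F := (continuous_source hp).comp hadm.continuous
  have hFb := abs_source_le hp hp1 hadm.odd hadm.mem_Icc
  have hd (x : ℝ) : HasDerivAt v (v' x) x := by
    have h := hasDerivAt_greenOp hFc x
    rwa [show greenOp F = v from hfix] at h
  have hd2 (x : ℝ) : HasDerivAt v' (v x - x / 2 * v' x - F x) x := by
    have h := hasDerivAt_greenOp' hFc x
    rwa [show greenOp F = v from hfix] at h
  have hderiv : deriv v = v' := funext fun x => (hd x).deriv
  have hv0 : v 0 = 0 := by rw [← hfix]; exact greenOp_zero
  have heven (x : ℝ) : v' (-x) = v' x := by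
    have h1 : HasDerivAt (fun y => -v (-y)) (v' (-x)) x :=
      HasDerivAt.congr_deriv (((hd (-x)).comp x (hasDerivAt_neg x)).neg) (by ring)
    have h2 : (fun y => -v (-y)) = v := by ext y; rw [hadm.odd, neg_neg]
    rw [h2] at h1
    exact h1.unique (hd x)
  have hvpos1 (x : ℝ) (hx : 1 ≤ x) : 0 < v x :=
    hv1.trans_le (hadm.monotoneOn (by simp) (show (0 : ℝ) ≤ x by linarith) hx)
  have hself (x : ℝ) (hx : 0 ≤ x) : v x ≤ F x := self_le_source hp hp1 (hadm.mem_Icc x hx)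
  have hmv (x : ℝ) : HasDerivAt (fun y => weight y * v' y) (-(weight x * (F x - v x))) x := by
    refine HasDerivAt.congr_deriv ((hasDerivAt_weight x).mul (hd2 x)) ?_
    ring
  have hmanti : AntitoneOn (fun y => weight y * v' y) (Ici 0) := by
    refine antitoneOn_of_hasDerivWithinAt_nonpos (convex_Ici 0)
      (fun x _ => (hmv x).continuousAt.continuousWithinAt)
      (fun x _ => (hmv x).hasDerivWithinAt) fun x hx => ?_
    rw [interior_Ici] at hx
    have := mul_nonneg (weight_pos x).le (sub_nonneg.2 (hself x (le_of_lt hx)))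
    linarith
  have hv'1 (x : ℝ) (hx : 1 ≤ x) : 0 < v' x := by
    have hx0 : 0 ≤ x := by linarith
    have hFx : 0 < F x := (hvpos1 x hx).trans_le (hself x hx0)
    exact (mul_pos hFx (by linarith [decaySol'_neg hx0])).trans_le
      (neg_mul_decaySol'_le_greenOp' hFc.measurable hFb
        (monotoneOn_source_comp hp hp1 hadm.mem_Icc hadm.monotoneOn) hx0)
  have hv'pos (x : ℝ) (hx : 0 ≤ x) : 0 < v' x := by
    have hx1 : (1 : ℝ) ≤ x + 1 := by linarith
    have h1 : weight (x + 1) * v' (x + 1) ≤ weight x * v' x :=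
      hmanti hx (show (0 : ℝ) ≤ x + 1 by linarith) (by linarith)
    exact (mul_pos_iff_of_pos_left (weight_pos x)).1
      ((mul_pos (weight_pos _) (hv'1 _ hx1)).trans_le h1)
  have hstrict : StrictMonoOn v (Ici 0) := by
    refine strictMonoOn_of_deriv_pos (convex_Ici 0) hadm.continuous.continuousOn fun x hx => ?_
    rw [interior_Ici] at hx
    rw [hderiv]
    exact hv'pos x (le_of_lt hx)
  have hvpos (x : ℝ) (hx : 0 < x) : 0 < v x := by
    have h := hstrict (le_refl (0 : ℝ)) hx.le hx
    rwa [hv0] at h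
  have hvlt (x : ℝ) (hx : 0 ≤ x) : v x < frontLimit p :=
    (hstrict hx (show (0 : ℝ) ≤ x + 1 by linarith) (by linarith)).trans_le
      (hadm.mem_Icc (x + 1) (by linarith)).2
  have hanti : StrictAntiOn v' (Ici 0) := by
    refine strictAntiOn_of_hasDerivAt_neg hd2 fun x hx => ?_
    have h1 := self_lt_source hp hp1 (hvpos x hx) (hvlt x hx.le)
    have h2 := mul_pos (half_pos hx) (hv'pos x hx.le)
    have h3 : F x = source p (v x) := rfl
    linarith
  have htop : Tendsto v atTop (𝓝 (frontLimit p)) := by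
    refine tendsto_order.2 ⟨fun l hl => ?_, fun l hl => ?_⟩
    swap
    · filter_upwards [eventually_ge_atTop 0] with x hx using (hvlt x hx).trans hl
    -- It suffices that `v` exceeds `l` somewhere on `[1, ∞)`.
    suffices h : ∃ x, 1 ≤ x ∧ l < v x by
      obtain ⟨x, hx, hlx⟩ := h
      filter_upwards [eventually_ge_atTop x] with y hy
      exact hlx.trans_le (hadm.monotoneOn (show (0 : ℝ) ≤ x by linarith)
        (show (0 : ℝ) ≤ y by linarith) hy)
    by_contra! hcon
    have hl0 : 0 < l := hv1.trans_le (hcon 1 le_rfl)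
    have hgap : 0 < l ^ (p - 1) - 1 / (1 - p) := sub_pos.2 (one_div_lt_rpow_sub_one hp1 hl0 hl)
    refine not_forall_nonneg_of_hasDerivAt_le (mul_pos hv1 hgap) hmv (fun x hx => ?_)
      fun x hx => (mul_pos (weight_pos x) (hv'1 x hx)).le
    have h1 := mul_le_source_sub_self hp hp1 (hvpos1 x hx.le) (hcon x hx.le)
    have h2 : v 1 ≤ v x := hadm.monotoneOn (by simp) (show (0 : ℝ) ≤ x by linarith) hx.le
    have h3 := mul_le_mul_of_nonneg_right h2 hgap.le
    have h4 : F x = source p (v x) := rfl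
    have h5 : 0 ≤ F x - v x := sub_nonneg.2 (hself x (by linarith))
    nlinarith [one_le_weight x]
  have hd0 : Tendsto v' atTop (𝓝 0) := by
    refine squeeze_zero' ?_ ?_ (tendsto_const_nhds.div_atTop tendsto_id (a := frontLimit p))
    · filter_upwards [eventually_ge_atTop 0] with x hx using (hv'pos x hx).le
    · filter_upwards [eventually_gt_atTop 0] with x hx
      obtain ⟨c, hc, hcx⟩ := exists_hasDerivAt_eq_slope v v' hx hadm.continuous.continuousOn
        fun y _ => hd y
      rw [hv0, sub_zero, sub_zero] at hcx
      calc v' x ≤ v' c := (hanti hc.1.le hx.le hc.2).le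
        _ = v x / x := hcx
        _ ≤ frontLimit p / x := div_le_div_of_nonneg_right (hvlt x hx.le).le hx.le
  have hode (x : ℝ) : v x - x / 2 * v' x - F x + x / 2 * v' x + fNonlin p (v x) -
      1 / (1 - p) * v x = 0 := by
    have h1 : 1 - p ≠ 0 := by linarith
    have h2 : F x = fNonlin p (v x) - p / (1 - p) * v x := rfl
    rw [h2]; field_simp; ring
  refine ⟨?_, fun x => ?_, hadm.odd, fun x => ?_, htop, ?_, ?_, ?_, fun x hx => ?_⟩
  · rw [show (2 : WithTop ℕ∞) = 1 + 1 by norm_num, contDiff_succ_iff_deriv]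
    refine ⟨fun x => (hd x).differentiableAt, by simp, ?_⟩
    rw [hderiv, contDiff_one_iff_deriv]
    refine ⟨fun x => (hd2 x).differentiableAt, ?_⟩
    have hv'c : Continuous v' := continuous_iff_continuousAt.2 fun x => (hd2 x).continuousAt
    have hvc := hadm.continuous
    rw [show deriv v' = fun x => v x - x / 2 * v' x - F x from funext fun x => (hd2 x).deriv]
    fun_prop
  · rw [hderiv, (hd2 x).deriv]
    exact hode x
  · rcases le_total 0 x with hx | hx
    · rw [abs_of_nonneg (hadm.mem_Icc x hx).1]; exact hvlt x hx
    · have hx' : 0 ≤ -x := by linarith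
      rw [← abs_neg, ← hadm.odd, abs_of_nonneg (hadm.mem_Icc _ hx').1]; exact hvlt _ hx'
  · refine (htop.comp tendsto_neg_atBot_atTop).neg.congr fun x => ?_
    simp [hadm.odd]
  · rw [hderiv]; exact hd0
  · rw [hderiv]
    exact (hd0.comp tendsto_neg_atBot_atTop).congr fun x => heven x
  · rw [hderiv]
    rcases lt_or_gt_of_ne hx with h | h
    · rw [← heven x]
      have hx' : 0 < -x := by linarith
      exact ⟨hv'pos _ hx'.le, hanti (le_refl (0 : ℝ)) hx'.le hx'⟩
    · exact ⟨hv'pos _ h.le, hanti (le_refl (0 : ℝ)) h.le h⟩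

theorem exists_isFrontProfile {p : ℝ} (hp : 0 < p) (hp1 : p < 1) : ∃ w, IsFrontProfile p w := by
  obtain ⟨v, hadm, hfix, hv1⟩ := exists_fixedPoint_profileOp hp hp1
  exact ⟨v, isFrontProfile_of_fixedPoint hp hp1 hadm hfix hv1⟩

/-! ### The slope at the origin as `p → 0` -/

section Profile

variable {p : ℝ} {w : ℝ → ℝ}

lemma hasDerivAt_profile (h : IsFrontProfile p w) (x : ℝ) : HasDerivAt w (deriv w x) x :=
  (h.contDiff.differentiable (by norm_num) x).hasDerivAt

lemma hasDerivAt_deriv_profile (hp1 : p < 1) (h : IsFrontProfile p w) (x : ℝ) :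
    HasDerivAt (deriv w) (w x - x / 2 * deriv w x - source p (w x)) x := by
  have h1 : ContDiff ℝ 1 (deriv w) :=
    ((contDiff_succ_iff_deriv (n := 1)).1 (by simpa [one_add_one_eq_two] using h.contDiff)).2.2
  refine HasDerivAt.congr_deriv (h1.differentiable (by norm_num) x).hasDerivAt ?_
  have h2 := h.ode x
  have h3 : p / (1 - p) + 1 = 1 / (1 - p) := by
    have : 1 - p ≠ 0 := by linarith
    field_simp; ring
  rw [source]
  linear_combination h2 - w x * h3

lemma profile_zero (h : IsFrontProfile p w) : w 0 = 0 := by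
  have := h.odd 0
  rw [neg_zero] at this
  linarith

lemma deriv_profile_pos (h : IsFrontProfile p w) (x : ℝ) : 0 < deriv w x := by
  rcases eq_or_ne x 0 with rfl | hx
  · have := h.deriv_pos_lt 1 one_ne_zero
    exact this.1.trans this.2
  · exact (h.deriv_pos_lt x hx).1

lemma strictMono_profile (h : IsFrontProfile p w) : StrictMono w :=
  strictMono_of_deriv_pos fun x => deriv_profile_pos h x

lemma profile_mem_Icc (h : IsFrontProfile p w) {x : ℝ} (hx : 0 ≤ x) :
    w x ∈ Icc 0 (frontLimit p) := by
  refine ⟨?_, (le_abs_self _).trans (h.abs_lt x).le⟩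
  rw [← profile_zero h]
  exact (strictMono_profile h).monotone hx

/-- The slope at the origin as an integral of the nonlinearity: Green's identity on `[0, ∞)` between
`w` and the solution `weight * decaySol` of the adjoint equation. -/
lemma deriv_profile_zero_eq (hp : 0 < p) (hp1 : p < 1) (h : IsFrontProfile p w) :
    deriv w 0 = ∫ s in Ioi (0 : ℝ), decaySol s * weight s * source p (w s) := by
  have hc : Continuous fun s => source p (w s) :=
    (continuous_source hp).comp h.contDiff.continuous
  have hderiv (x : ℝ) :
      HasDerivAt (fun y => weight y * decaySol' y * w y - weight y * decaySol y * deriv w y)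
        (decaySol x * weight x * source p (w x)) x := by
    refine HasDerivAt.congr_deriv (((hasDerivAt_weight_mul_decaySol' x).mul
      (hasDerivAt_profile h x)).sub (((hasDerivAt_weight x).mul (hasDerivAt_decaySol x)).mul
      (hasDerivAt_deriv_profile hp1 h x))) ?_
    simp only [Pi.mul_apply]; ring
  have hlim : Tendsto
      (fun y => weight y * decaySol' y * w y - weight y * decaySol y * deriv w y) atTop (𝓝 0) := by
    simpa using (tendsto_weight_mul_decaySol'.mul h.tendsto_atTop).sub
      (tendsto_weight_mul_decaySol.mul h.deriv_tendsto_atTop)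
  rw [integral_Ioi_of_hasDerivAt_of_tendsto' (fun x _ => hderiv x)
    (integrableOn_decaySol_mul_of_bounded hc.measurable
      (abs_source_le hp hp1 h.odd fun s hs => profile_mem_Icc h hs) le_rfl) hlim]
  simp [weight_zero, decaySol_zero, profile_zero h]

/-- A primitive of `source p u - u` on `[0, ∞)`, the potential energy of the profile equation. -/
noncomputable def potential (p u : ℝ) : ℝ :=
  u ^ (p + 1) / (p + 1) - p / (1 - p) * (u ^ 2 / 2) - u ^ 2 / 2

lemma hasDerivAt_potential (hp : 0 < p) {u : ℝ} (hu : 0 ≤ u) :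
    HasDerivAt (potential p) (source p u - u) u := by
  have h1 := (Real.hasDerivAt_rpow_const (x := u) (p := p + 1) (Or.inr (by linarith))).div_const
    (p + 1)
  have h2 := ((hasDerivAt_id u).pow 2).div_const 2
  refine HasDerivAt.congr_deriv ((h1.sub (h2.const_mul (p / (1 - p)))).sub h2) ?_
  rw [source_of_nonneg hp hu, add_sub_cancel_right]
  have : p + 1 ≠ 0 := by linarith
  simp; field_simp

lemma potential_frontLimit (hp : 0 < p) (hp1 : p < 1) :
    potential p (frontLimit p) = frontLimit p ^ 2 / (2 * (1 + p)) := by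
  have hL := frontLimit_pos hp1
  have h1 : 1 - p ≠ 0 := by linarith
  have h2 : p + 1 ≠ 0 := by linarith
  have h3 : 1 + p ≠ 0 := by linarith
  rw [potential, Real.rpow_add_one hL.ne', frontLimit_rpow hp1]
  field_simp
  ring

/-- The energy `w'²/2 + potential p w` decreases to `potential p (frontLimit p)`, which bounds the
slope below wherever `w` is small. -/
lemma le_deriv_profile_sq (hp : 0 < p) (hp1 : p < 1) (h : IsFrontProfile p w) {x : ℝ}
    (hx : 0 ≤ x) : frontLimit p ^ 2 / 2 - 2 * w x ≤ deriv w x ^ 2 := by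
  have hL := frontLimit_pos hp1
  have hE (y : ℝ) (hy : 0 ≤ y) : HasDerivAt (fun y => deriv w y ^ 2 / 2 + potential p (w y))
      (-(y / 2 * deriv w y ^ 2)) y := by
    refine HasDerivAt.congr_deriv ((((hasDerivAt_deriv_profile hp1 h y).pow 2).div_const 2).add
      ((hasDerivAt_potential hp (profile_mem_Icc h hy).1).comp y (hasDerivAt_profile h y))) ?_
    simp; ring
  have hanti : AntitoneOn (fun y => deriv w y ^ 2 / 2 + potential p (w y)) (Ici 0) := by
    refine antitoneOn_of_hasDerivWithinAt_nonpos (convex_Ici 0)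
      (fun y hy => (hE y hy).continuousAt.continuousWithinAt)
      (f' := fun y => -(y / 2 * deriv w y ^ 2)) (fun y hy => ?_) fun y hy => ?_
    all_goals
      rw [interior_Ici] at hy
      have hy0 : 0 ≤ y := le_of_lt hy
    · exact (hE y hy0).hasDerivWithinAt
    · have : 0 ≤ y / 2 * deriv w y ^ 2 := by positivity
      linarith
  have hlim : Tendsto (fun y => deriv w y ^ 2 / 2 + potential p (w y)) atTop
      (𝓝 (potential p (frontLimit p))) := by
    simpa using ((h.deriv_tendsto_atTop.pow 2).div_const 2).add
      ((hasDerivAt_potential hp hL.le).continuousAt.tendsto.comp h.tendsto_atTop)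
  have hle : potential p (frontLimit p) ≤ deriv w x ^ 2 / 2 + potential p (w x) := by
    refine le_of_tendsto hlim ?_
    filter_upwards [eventually_ge_atTop x] with y hy
    exact hanti hx (hx.trans hy) hy
  have hV : frontLimit p ^ 2 / 4 ≤ potential p (frontLimit p) := by
    rw [potential_frontLimit hp hp1]
    exact div_le_div_of_nonneg_left (by positivity) (by linarith) (by linarith)
  have hw := profile_mem_Icc h hx
  have hw1 : w x ≤ 1 := hw.2.trans (frontLimit_le_one hp.le hp1)
  have hVw : potential p (w x) ≤ w x := by
    have h1 : w x ^ (p + 1) ≤ w x ^ (1 : ℝ) :=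
      Real.rpow_le_rpow_of_exponent_ge' hw.1 hw1 zero_le_one (by linarith)
    rw [Real.rpow_one] at h1
    have h2 : w x ^ (p + 1) / (p + 1) ≤ w x ^ (p + 1) :=
      div_le_self (Real.rpow_nonneg hw.1 _) (by linarith)
    have h3 : 0 ≤ p / (1 - p) * (w x ^ 2 / 2) := by
      have : 0 < 1 - p := by linarith
      positivity
    have h4 : 0 ≤ w x ^ 2 / 2 := by positivity
    unfold potential
    linarith
  linarith

/-- While `w ≤ L²/16`, the energy bound gives `w' ≥ L/2`. -/
lemma min_le_profile (hp : 0 < p) (hp1 : p < 1) (h : IsFrontProfile p w) {x : ℝ} (hx : 0 < x) :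
    min (frontLimit p ^ 2 / 16) (frontLimit p / 2 * x) ≤ w x := by
  have hL := frontLimit_pos hp1
  by_cases hcase : frontLimit p ^ 2 / 16 ≤ w x
  · exact (min_le_left _ _).trans hcase
  · refine (min_le_right _ _).trans ?_
    obtain ⟨c, hc, hcx⟩ := exists_hasDerivAt_eq_slope w (deriv w) hx
      h.contDiff.continuous.continuousOn fun y _ => hasDerivAt_profile h y
    rw [profile_zero h, sub_zero, sub_zero] at hcx
    have h1 := le_deriv_profile_sq hp hp1 h hc.1.le
    have h2 := (strictMono_profile h) hc.2
    have h3 : frontLimit p / 2 ≤ deriv w c :=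
      le_of_sq_le_sq (by nlinarith) (deriv_profile_pos h c).le
    rw [hcx, le_div_iff₀ hx] at h3
    exact h3

end Profile

lemma tendsto_frontLimit : Tendsto frontLimit (𝓝 0) (𝓝 1) := by
  have h : ContinuousAt frontLimit 0 := by
    unfold frontLimit
    refine ContinuousAt.rpow (by fun_prop) ?_ (Or.inl (by norm_num))
    exact continuousAt_const.div (by fun_prop) (by norm_num)
  simpa [ContinuousAt, frontLimit] using h

/-- In `w'(0) = ∫ decaySol * weight * source p w`, the factor `source p w` is at most `1` and tends
to `1` pointwise, because `w` is bounded away from `0` at each point uniformly in `p`. -/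
theorem tendsto_deriv_profile_zero {q : ℕ → ℝ} {w : ℕ → ℝ → ℝ} (hq : ∀ n, q n ∈ Ioo (0 : ℝ) 1)
    (hq0 : Tendsto q atTop (𝓝 0)) (hw : ∀ n, IsFrontProfile (q n) (w n)) :
    Tendsto (fun n => deriv (w n) 0) atTop (𝓝 (2 / √Real.pi)) := by
  have hint : ∫ s in Ioi (0 : ℝ), decaySol s * weight s * 1 = 2 / √Real.pi := by
    simp only [mul_one]
    rw [integral_decaySol_mul_weight le_rfl, decaySol'_zero, weight_zero]; ring
  rw [← hint]
  simp only [fun n => deriv_profile_zero_eq (hq n).1 (hq n).2 (hw n)]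
  have hle (n : ℕ) (s : ℝ) (hs : 0 ≤ s) : source (q n) (w n s) ∈ Icc 0 (1 : ℝ) := by
    have h := source_mem_Icc (hq n).1 (hq n).2 (profile_mem_Icc (hw n) hs)
    exact ⟨h.1, h.2.trans (frontLimit_le_one (hq n).1.le (hq n).2)⟩
  have hlim (s : ℝ) (hs : 0 < s) : Tendsto (fun n => source (q n) (w n s)) atTop (𝓝 1) := by
    set c : ℝ := min (1 / 64) (s / 4) with hc
    have hcpos : 0 < c := lt_min (by norm_num) (by linarith)
    have hlow : Tendsto (fun n => c ^ q n - q n / (1 - q n)) atTop (𝓝 1) := by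
      have h1 : Tendsto (fun n => c ^ q n) atTop (𝓝 (c ^ (0 : ℝ))) :=
        tendsto_const_nhds.rpow hq0 (Or.inl hcpos.ne')
      have h2 : Tendsto (fun n => q n / (1 - q n)) atTop (𝓝 (0 / (1 - 0))) :=
        hq0.div (hq0.const_sub 1) (by norm_num)
      simpa using h1.sub h2
    refine tendsto_of_tendsto_of_tendsto_of_le_of_le' hlow tendsto_const_nhds ?_
      (Eventually.of_forall fun n => (hle n s hs.le).2)
    filter_upwards [(tendsto_frontLimit.comp hq0).eventually
      (lt_mem_nhds (show (1 / 2 : ℝ) < 1 by norm_num))] with n hn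
    simp only [Function.comp_apply] at hn
    have hcw : c ≤ w n s := by
      refine le_trans ?_ (min_le_profile (hq n).1 (hq n).2 (hw n) hs)
      exact min_le_min (by nlinarith) (by nlinarith)
    have hmem := profile_mem_Icc (hw n) hs.le
    have hw1 : w n s ≤ 1 := hmem.2.trans (frontLimit_le_one (hq n).1.le (hq n).2)
    rw [source_of_nonneg (hq n).1 hmem.1]
    have h1 : c ^ q n ≤ w n s ^ q n := Real.rpow_le_rpow hcpos.le hcw (hq n).1.le
    have h2 : q n / (1 - q n) * w n s ≤ q n / (1 - q n) :=
      mul_le_of_le_one_right (div_nonneg (hq n).1.le (by linarith [(hq n).2])) hw1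
    linarith
  refine tendsto_integral_of_dominated_convergence (fun s => decaySol s * weight s)
    (fun n => ?_) (integrableOn_decaySol_mul_weight le_rfl) (fun n => ?_) ?_
  · exact (continuous_decaySol_mul_weight.mul
      ((continuous_source (hq n).1).comp (hw n).contDiff.continuous)).aestronglyMeasurable
  · refine (ae_restrict_mem measurableSet_Ioi).mono fun s hs => ?_
    have h1 := decaySol_mul_weight_nonneg (le_of_lt hs)
    have h2 := hle n s (le_of_lt hs)
    rw [Real.norm_eq_abs, abs_of_nonneg (mul_nonneg h1 h2.1)]
    exact mul_le_of_le_one_right h1 h2.2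
  · exact (ae_restrict_mem measurableSet_Ioi).mono fun s hs => (hlim s hs).const_mul _

/-! ### The derivative functional of the self-similar solution -/

/-- The Beta integral on `[0, t]` with second parameter `1/2`. -/
lemma integral_rpow_div_sqrt {a t : ℝ} (ha : 0 ≤ a) (ht : 0 < t) :
    ∫ τ in (0 : ℝ)..t, τ ^ a / √(t - τ) =
      t ^ (a + 1 / 2) * (Real.Gamma (a + 1) * √Real.pi / Real.Gamma (a + 3 / 2)) := by
  have h := Complex.betaIntegral_scaled ((a + 1 : ℝ) : ℂ) ((1 / 2 : ℝ) : ℂ) ht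
  rw [Complex.betaIntegral_eq_Gamma_mul_div _ _ (by simp; linarith) (by simp)] at h
  have hl : ∫ x in (0 : ℝ)..t, (x : ℂ) ^ (((a + 1 : ℝ) : ℂ) - 1) *
      ((t : ℂ) - x) ^ (((1 / 2 : ℝ) : ℂ) - 1) =
      ((∫ τ in (0 : ℝ)..t, τ ^ a / √(t - τ) : ℝ) : ℂ) := by
    rw [← intervalIntegral.integral_ofReal]
    refine intervalIntegral.integral_congr fun x hx => ?_
    rw [uIcc_of_le ht.le] at hx
    have h1 : 0 ≤ t - x := sub_nonneg.2 hx.2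
    have h2 : (t - x) ^ (1 / 2 - 1 : ℝ) = (√(t - x))⁻¹ := by
      rw [Real.sqrt_eq_rpow, ← Real.rpow_neg h1]; norm_num
    have h3 : x ^ a / √(t - x) = x ^ a * (t - x) ^ (1 / 2 - 1 : ℝ) := by rw [h2, div_eq_mul_inv]
    rw [h3, Complex.ofReal_mul, Complex.ofReal_cpow hx.1,
      Complex.ofReal_cpow h1]
    push_cast
    ring_nf
  rw [hl, ← Complex.ofReal_add, Complex.Gamma_ofReal, Complex.Gamma_ofReal, Complex.Gamma_ofReal,
    ← Complex.ofReal_one, ← Complex.ofReal_sub, ← Complex.ofReal_cpow ht.le,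
    ← Complex.ofReal_mul, ← Complex.ofReal_div, ← Complex.ofReal_mul, Complex.ofReal_inj,
    Real.Gamma_one_half_eq] at h
  rw [h]
  ring_nf

lemma supNorm_fNonlin_selfSimilar {p : ℝ} (hp : 0 < p) (hp1 : p < 1) {w : ℝ → ℝ}
    (h : IsFrontProfile p w) {τ : ℝ} (hτ : 0 < τ) :
    supNorm (fun x => fNonlin p (selfSimilar p w x τ)) =
      (1 - p) ^ (p / (1 - p)) * τ ^ (p / (1 - p)) := by
  have hq : 0 < 1 - p := by linarith
  have hL := frontLimit_pos hp1
  have hLp : (1 - p) ^ (p / (1 - p)) = frontLimit p ^ p := by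
    rw [frontLimit, ← Real.rpow_mul hq.le]; congr 1; ring
  have hval (x : ℝ) : |fNonlin p (selfSimilar p w x τ)| =
      |w (x / √τ)| ^ p * τ ^ (p / (1 - p)) := by
    rw [abs_fNonlin hp, selfSimilar, abs_mul, abs_of_pos (Real.rpow_pos_of_pos hτ _),
      Real.mul_rpow (abs_nonneg _) (Real.rpow_nonneg hτ.le _), ← Real.rpow_mul hτ.le]
    congr 2; ring
  have hle (x : ℝ) : |fNonlin p (selfSimilar p w x τ)| ≤
      frontLimit p ^ p * τ ^ (p / (1 - p)) := by
    rw [hval]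
    exact mul_le_mul_of_nonneg_right
      (Real.rpow_le_rpow (abs_nonneg _) (h.abs_lt _).le hp.le) (Real.rpow_nonneg hτ.le _)
  rw [supNorm, hLp]
  refine le_antisymm (ciSup_le hle) ?_
  have hlim : Tendsto (fun x => |fNonlin p (selfSimilar p w x τ)|) atTop
      (𝓝 (frontLimit p ^ p * τ ^ (p / (1 - p)))) := by
    simp only [hval]
    have h1 : Tendsto (fun x => |w (x / √τ)|) atTop (𝓝 |frontLimit p|) :=
      (h.tendsto_atTop.comp (tendsto_id.atTop_div_const (Real.sqrt_pos.2 hτ))).abs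
    rw [abs_of_pos hL] at h1
    exact (h1.rpow_const (Or.inl hL.ne')).mul_const _
  exact le_of_tendsto' hlim fun x => le_ciSup (f := fun x => |fNonlin p (selfSimilar p w x τ)|)
    ⟨_, by rintro _ ⟨y, rfl⟩; exact hle y⟩ x

theorem derivFunctional_selfSimilar {p : ℝ} (hp : 0 < p) (hp1 : p < 1) {w : ℝ → ℝ}
    (h : IsFrontProfile p w) {t : ℝ} (ht : 0 < t) :
    derivFunctional t (fNonlin p) (fun _ => 0) (selfSimilar p w) =
      phiBound p * t ^ ((1 + p) / (2 * (1 - p))) := by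
  have hq : 0 < 1 - p := by linarith
  have hint : ∫ τ in (0 : ℝ)..t, supNorm (fun x => fNonlin p (selfSimilar p w x τ)) / √(t - τ) =
      ∫ τ in (0 : ℝ)..t, (1 - p) ^ (p / (1 - p)) * (τ ^ (p / (1 - p)) / √(t - τ)) := by
    refine intervalIntegral.integral_congr_ae (ae_of_all _ fun τ hτ => ?_)
    rw [uIoc_of_le ht.le] at hτ
    rw [supNorm_fNonlin_selfSimilar hp hp1 h hτ.1, mul_div_assoc]
  have h1 : p / (1 - p) + 1 = 1 / (1 - p) := by field_simp; ring
  have h2 : p / (1 - p) + 3 / 2 = (3 - p) / (2 * (1 - p)) := by field_simp; ring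
  have h3 : p / (1 - p) + 1 / 2 = (1 + p) / (2 * (1 - p)) := by field_simp; ring
  have hπ := sqrt_pi_pos.ne'
  rw [derivFunctional, hint, intervalIntegral.integral_const_mul,
    integral_rpow_div_sqrt (by positivity) ht, h1, h2, h3, phiBound]
  simp only [supNorm, deriv_const, abs_zero, ciSup_const, zero_add]
  field_simp

theorem tendsto_phiBound : Tendsto phiBound (𝓝[>] 0) (𝓝 (2 / √Real.pi)) := by
  have hG (x : ℝ) (hx : 0 < x) : ContinuousAt Real.Gamma x :=
    (Real.differentiableAt_Gamma fun m => by
      have : (0 : ℝ) ≤ m := m.cast_nonneg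
      linarith).continuousAt
  have h32 : Real.Gamma (3 / 2) = √Real.pi / 2 := by
    rw [show (3 / 2 : ℝ) = 1 / 2 + 1 by norm_num, Real.Gamma_add_one (by norm_num),
      Real.Gamma_one_half_eq]; ring
  have h : ContinuousAt phiBound 0 := by
    unfold phiBound
    refine ContinuousAt.div (ContinuousAt.mul (ContinuousAt.rpow (by fun_prop) ?_
      (Or.inl (by norm_num))) (ContinuousAt.comp (g := Real.Gamma) (hG _ (by norm_num)) ?_))
      (ContinuousAt.comp (g := Real.Gamma) (hG _ (by norm_num)) ?_) ?_
    · exact continuousAt_id.div (by fun_prop) (by norm_num)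
    · exact continuousAt_const.div (by fun_prop) (by norm_num)
    · exact ContinuousAt.div (by fun_prop) (by fun_prop) (by norm_num)
    · exact (Real.Gamma_pos_of_pos (by norm_num)).ne'
  have h0 : phiBound 0 = 2 / √Real.pi := by
    simp [phiBound, h32]
  rw [← h0]
  exact h.tendsto.mono_left nhdsWithin_le_nhds

lemma tendsto_pSeq_succ : Tendsto (fun l => pSeq (l + 1)) atTop (𝓝 0) := by
  have h := (tendsto_one_div_add_atTop_nhds_zero_nat (𝕜 := ℝ)).const_mul (1 / 2)
  rw [mul_zero] at h
  refine h.congr fun l => ?_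
  simp only [pSeq]; push_cast; field_simp

lemma pSeq_succ_mem_Ioo (l : ℕ) : pSeq (l + 1) ∈ Ioo (0 : ℝ) 1 := by
  have hl : (0 : ℝ) ≤ l := l.cast_nonneg
  unfold pSeq
  push_cast
  exact ⟨by positivity, (div_lt_one (by positivity)).2 (by linarith)⟩

end FrontProfile

open FrontProfile in
theorem mainTheorem7 :
    (∀ p ∈ Ioo (0 : ℝ) 1, ∃ w : ℝ → ℝ, IsFrontProfile p w) ∧
    (∀ w : ℝ → ℝ → ℝ, (∀ p ∈ Ioo (0 : ℝ) 1, IsFrontProfile p (w p)) →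
      (∃ n : ℕ → ℕ, StrictMono n ∧ (∀ l, 1 ≤ n l) ∧
        Tendsto (fun l => pSeq (n l)) atTop (𝓝 0) ∧
        Tendsto (fun l => deriv (w (pSeq (n l))) 0) atTop (𝓝 (2 / √Real.pi))) ∧
      (∀ p ∈ Ioo (0 : ℝ) 1, ∀ t : ℝ, 0 < t →
        derivFunctional t (fNonlin p) (fun _ => 0) (selfSimilar p (w p)) =
          phiBound p * t ^ ((1 + p) / (2 * (1 - p))))) ∧
    Tendsto phiBound (𝓝[>] 0) (𝓝 (2 / √Real.pi)) := by
  refine ⟨fun p hp => exists_isFrontProfile hp.1 hp.2, fun w hw => ⟨?_, fun p hp t ht =>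
    derivFunctional_selfSimilar hp.1 hp.2 (hw p hp) ht⟩, tendsto_phiBound⟩
  -- The whole sequence converges, so the subsequence only skips the index `0`.
  exact ⟨fun l => l + 1, fun a b hab => Nat.succ_lt_succ hab, fun l => Nat.le_add_left 1 l,
    tendsto_pSeq_succ, tendsto_deriv_profile_zero pSeq_succ_mem_Ioo tendsto_pSeq_succ
      fun l => hw _ (pSeq_succ_mem_Ioo l)⟩
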